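/- Let $R$ be a commutative ring with unit, $G$ a group, and $\mathcal{F}$ a non-empty collection of finite subgroups of $G$ that is closed under conjugation and under taking subgroups. Let $\Delta=\coprod_{H\in\mathcal{F}}G/H$. An $RG$-module is *$\mathcal{F}$-projective* if it is a direct summand of $N\otimes_R R\Delta$ (with the diagonal action) for some $RG$-module $N$. A resolution of $RG$-modules is *$\mathcal{F}$-split* if, for each $H\in\mathcal{F}$, the augmented complex splits when restricted to $RH$, i.e. has an $RH$-linear contracting homotopy. The *$\mathcal{F}$-cohomological dimension* $\mathcal{F}\mathrm{cd}\,G\in\mathbb{N}\cup\{\infty\}$ is the shortest length of an $\mathcal{F}$-split resolution of the trivial $RG$-module $R$ by $\mathcal{F}$-projective $RG$-modules. Let $\mathcal{H}_{\mathcal{F}}$ be the Hecke category: its objects are the $G$-sets $G/H$ with $H\in\mathcal{F}$, and the morphisms $G/H\to G/K$ are the $\mathbb{Z}G$-module homomorphisms $\mathbb{Z}[G/H]\to\mathbb{Z}[G/K]$. An $\mathcal{H}_{\mathcal{F}}$-module (equivalently, a cohomological Mackey functor) is a contravariant additive functor from $\mathcal{H}_{\mathcal{F}}$ to $R$-modules.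 For an $RG$-module $M$, the fixed point functor $M^-$ is the $\mathcal{H}_{\mathcal{F}}$-module $G/H\mapsto M^H$, on which a morphism $f:\mathbb{Z}[G/H]\to\mathbb{Z}[G/K]$ with $f(H)=\sum_x a_x\,xK$ acts by $M^K\to M^H$, $m\mapsto\sum_x a_x\,xm$. The *$\mathcal{H}_{\mathcal{F}}$-cohomological dimension* $\mathcal{H}_{\mathcal{F}}\mathrm{cd}\,G\in\mathbb{N}\cup\{\infty\}$ is the length of the shortest resolution of $R^-$ (the fixed point functor of the trivial module $R$) by projective $\mathcal{H}_{\mathcal{F}}$-modules. Then $$\mathcal{F}\mathrm{cd}\,G=\mathcal{H}_{\mathcal{F}}\mathrm{cd}\,G .$$ -/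

import Mathlib

open CategoryTheory
open scoped TensorProduct

universe u v

/-- A family of finite subgroups of `G`: a non-empty collection of finite subgroups, closed under
conjugation and under taking subgroups. -/
structure FiniteSubgroupFamily (G : Type v) [Group G] where
  /-- the subgroups belonging to the family -/
  carrier : Set (Subgroup G)
  nonempty : carrier.Nonempty
  finite_mem : ∀ H ∈ carrier, Finite H
  conj_mem : ∀ H ∈ carrier, ∀ g : G, H.map (MulAut.conj g).toMonoidHom ∈ carrier
  le_mem : ∀ H ∈ carrier, ∀ K : Subgroup G, K ≤ H → K ∈ carrier

/-! ### Relative homological algebra: the `𝓕`-cohomological dimension -/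

section FCohomology

variable (R : Type u) [CommRing R] {G : Type v} [Group G] (𝓕 : FiniteSubgroupFamily G)

/-- The `G`-set `Δ = ∐_{H ∈ 𝓕} G/H`. -/
abbrev FiniteSubgroupFamily.Delta : Type v := Σ H : 𝓕.carrier, G ⧸ H.1

/-- The trivial `RG`-module `R` (lifted to the universe containing both `R` and `G`). -/
noncomputable abbrev trivialRep (R : Type u) [CommRing R] (G : Type v) [Group G] :
    Rep.{max u v} R G :=
  Rep.of (Representation.trivial R G (ULift.{v} R))

variable {R}

/-- An `RG`-module is `𝓕`-projective if it is a direct summand of `N ⊗ RΔ` (diagonal action) for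
some `RG`-module `N`. -/
def IsFProjective (P : Rep.{max u v} R G) : Prop :=
  ∃ N : Rep.{max u v} R G,
    Nonempty (Retract P (Rep.of (N.ρ.tprod (Representation.ofMulAction R G 𝓕.Delta))))

/-- A resolution `⋯ ⟶ P₁ ⟶ P₀ ⟶ M ⟶ 0` of an `RG`-module `M`. -/
structure RepResolution (M : Rep.{max u v} R G) where
  /-- the modules of the resolution -/
  P : ℕ → Rep.{max u v} R G
  /-- the differentials -/
  d : ∀ i, P (i + 1) ⟶ P i
  /-- the augmentation -/
  ε : P 0 ⟶ M
  surjective_ε : Function.Surjective ε.hom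
  exact_zero : Function.Exact (d 0).hom ε.hom
  exact_succ : ∀ i, Function.Exact (d (i + 1)).hom (d i).hom

/-- The restriction of an `RG`-module to a subgroup `H`. -/
abbrev restrictRep (M : Rep.{max u v} R G) (H : Subgroup G) : Representation R H M :=
  M.ρ.comp H.subtype

/-- The augmented complex splits over `H`: it has an `RH`-linear contracting homotopy. -/
def RepResolution.SplitsOver {M : Rep.{max u v} R G} (C : RepResolution M) (H : Subgroup G) :
    Prop :=
  ∃ (t : (restrictRep M H).IntertwiningMap (restrictRep (C.P 0) H))
    (s : ∀ i, (restrictRep (C.P i) H).IntertwiningMap (restrictRep (C.P (i + 1)) H)),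
    (∀ m, C.ε.hom (t m) = m) ∧
    (∀ x, (C.d 0).hom (s 0 x) + t (C.ε.hom x) = x) ∧
    (∀ i x, (C.d (i + 1)).hom (s (i + 1) x) + s i ((C.d i).hom x) = x)

/-- `R` has an `𝓕`-split resolution of length at most `n` by `𝓕`-projective `RG`-modules. -/
def HasFResolution (R : Type u) [CommRing R] {G : Type v} [Group G] (𝓕 : FiniteSubgroupFamily G)
    (n : ℕ) : Prop :=
  ∃ C : RepResolution (trivialRep R G),
    (∀ i, IsFProjective 𝓕 (C.P i)) ∧
    (∀ H ∈ 𝓕.carrier, C.SplitsOver H) ∧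
    (∀ i, n < i → Subsingleton (C.P i))

/-- The `𝓕`-cohomological dimension `𝓕cd G` over `R`: the shortest length of an `𝓕`-split
resolution of `R` by `𝓕`-projective `RG`-modules (`⊤` if there is none of finite length). -/
noncomputable def FCohomologicalDimension (R : Type u) [CommRing R] {G : Type v} [Group G]
    (𝓕 : FiniteSubgroupFamily G) : ℕ∞ :=
  sInf {N : ℕ∞ | ∃ n : ℕ, N = n ∧ HasFResolution R 𝓕 n}

end FCohomology

/-! ### The Hecke category, its modules, and the fixed point functors -/

section Hecke

variable {G : Type v} [Group G]

/-- The Hecke category `ℋ_𝓕`: the objects are the transitive `G`-sets `G/H` with `H ∈ 𝓕`, and the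
morphisms `G/H ⟶ G/K` are the `ℤG`-module homomorphisms `ℤ[G/H] → ℤ[G/K]`. -/
structure HeckeCat (𝓕 : FiniteSubgroupFamily G) where
  /-- the stabiliser -/
  sub : Subgroup G
  mem : sub ∈ 𝓕.carrier

namespace HeckeCat

variable {𝓕 : FiniteSubgroupFamily G}

/-- The permutation module `ℤ[G/H]`. -/
noncomputable abbrev perm (X : HeckeCat 𝓕) :
    Representation ℤ G (MonoidAlgebra ℤ (G ⧸ X.sub)) :=
  Representation.ofMulAction ℤ G (G ⧸ X.sub)

noncomputable instance : Category (HeckeCat 𝓕) where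
  Hom X Y := X.perm.IntertwiningMap Y.perm
  id X := .id X.perm
  comp f g := g.comp f

noncomputable instance : Preadditive (HeckeCat 𝓕) where
  homGroup X Y := inferInstanceAs (AddCommGroup (X.perm.IntertwiningMap Y.perm))
  add_comp _ _ _ f f' g := Representation.IntertwiningMap.add_comp _ _ _ g f f'
  comp_add _ _ _ f g g' := Representation.IntertwiningMap.comp_add _ _ _ g g' f

/-- The morphism of `ℋ_𝓕` as a `ℤG`-homomorphism `ℤ[G/H] → ℤ[G/K]`. -/
noncomputable def toMap {X Y : HeckeCat 𝓕} (f : X ⟶ Y) : X.perm.IntertwiningMap Y.perm := f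

/-- The generator `H` of the `ℤG`-module `ℤ[G/H]`. -/
noncomputable abbrev gen (X : HeckeCat 𝓕) : MonoidAlgebra ℤ (G ⧸ X.sub) :=
  MonoidAlgebra.single ((1 : G) : G ⧸ X.sub) 1

end HeckeCat

/-- The category of `ℋ_𝓕`-modules over `R`: contravariant additive functors from `ℋ_𝓕` to
`R`-modules. -/
abbrev HeckeModule (R : Type u) [CommRing R] (𝓕 : FiniteSubgroupFamily G) :=
  (HeckeCat 𝓕)ᵒᵖ ⥤+ ModuleCat.{max u v} R

section FixedPoints

variable {R : Type u} [CommRing R] {𝓕 : FiniteSubgroupFamily G} (M : Rep.{max u v} R G)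

/-- The fixed points `M^H` of the subgroup `H`. -/
noncomputable abbrev fixedPoints (H : Subgroup G) : Submodule R M :=
  Representation.invariants (restrictRep M H)

/-- For `m ∈ M^H`, the well-defined map `G/H → M`, `gH ↦ g m`. -/
noncomputable def orbitFun {H : Subgroup G} (m : fixedPoints M H) : G ⧸ H → M :=
  Quotient.lift (fun g : G => M.ρ g m.1) (by
    intro a b hab
    have h : a⁻¹ * b ∈ H := QuotientGroup.leftRel_apply.mp hab
    have h2 : M.ρ (a⁻¹ * b) m.1 = m.1 := m.2 ⟨_, h⟩
    have h3 : M.ρ b m.1 = M.ρ a (M.ρ (a⁻¹ * b) m.1) := by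
      rw [← Module.End.mul_apply, ← map_mul, mul_inv_cancel_left]
    change M.ρ a m.1 = M.ρ b m.1
    rw [h3, h2])

/-- For `m ∈ M^H`, the `ℤG`-homomorphism `ℤ[G/H] → M`, `gH ↦ g m`. -/
noncomputable def orbitMap {H : Subgroup G} (m : fixedPoints M H) :
    MonoidAlgebra ℤ (G ⧸ H) →ₗ[ℤ] M :=
  Finsupp.linearCombination ℤ (orbitFun M m) ∘ₗ
    (MonoidAlgebra.coeffLinearEquiv ℤ).toLinearMap

theorem orbitFun_smul {H : Subgroup G} (m : fixedPoints M H) (g : G) (x : G ⧸ H) :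
    orbitFun M m (g • x) = M.ρ g (orbitFun M m x) := by
  induction x using Quotient.inductionOn with
  | _ a =>
    change M.ρ (g * a) m.1 = M.ρ g (M.ρ a m.1)
    rw [map_mul, Module.End.mul_apply]

theorem orbitMap_single {H : Subgroup G} (m : fixedPoints M H) (x : G ⧸ H) (z : ℤ) :
    orbitMap M m (MonoidAlgebra.single x z) = z • orbitFun M m x := by
  simp [orbitMap]

theorem orbitMap_equivariant {H : Subgroup G} (m : fixedPoints M H) (g : G)
    (v : MonoidAlgebra ℤ (G ⧸ H)) :
    orbitMap M m (Representation.ofMulAction ℤ G (G ⧸ H) g v) = M.ρ g (orbitMap M m v) := by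
  induction v using MonoidAlgebra.induction_linear with
  | zero => simp
  | add a b ha hb => simp only [map_add, ha, hb]
  | single x z =>
    rw [Representation.ofMulAction_single, orbitMap_single, orbitMap_single, orbitFun_smul,
      map_zsmul]

theorem gen_fixed (X : HeckeCat 𝓕) (h : X.sub) : X.perm h.1 X.gen = X.gen := by
  rw [Representation.ofMulAction_single]
  congr 1
  exact QuotientGroup.eq.mpr (by simp)

/-- The action of a Hecke morphism `f : ℤ[G/H] → ℤ[G/K]` on fixed points: if `f(H) = ∑ aₓ xK`, then
`m ∈ M^K` is sent to `∑ aₓ x m ∈ M^H`. -/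
noncomputable def fixedPointsMap {X Y : HeckeCat 𝓕} (f : X ⟶ Y) :
    fixedPoints M Y.sub →ₗ[R] fixedPoints M X.sub where
  toFun m := ⟨orbitMap M m (HeckeCat.toMap f X.gen), fun h => by
    change M.ρ h.1 _ = _
    rw [← orbitMap_equivariant, ← Representation.IntertwiningMap.isIntertwining, gen_fixed]⟩
  map_add' m m' := by
    apply Subtype.ext
    change orbitMap M (m + m') _ = orbitMap M m _ + orbitMap M m' _
    generalize HeckeCat.toMap f X.gen = v
    induction v using MonoidAlgebra.induction_linear with
    | zero => simp
    | add a b ha hb => simp only [map_add, ha, hb]; abel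
    | single x z =>
      simp only [orbitMap_single, ← smul_add]
      congr 1
      induction x using Quotient.inductionOn with
      | _ a => exact map_add (M.ρ a) m.1 m'.1
  map_smul' r m := by
    apply Subtype.ext
    change orbitMap M (r • m) _ = r • orbitMap M m _
    generalize HeckeCat.toMap f X.gen = v
    induction v using MonoidAlgebra.induction_linear with
    | zero => simp
    | add a b ha hb => simp only [map_add, ha, hb, smul_add]
    | single x z =>
      rw [orbitMap_single, orbitMap_single, smul_comm r z]
      congr 1
      induction x using Quotient.inductionOn with
      | _ a => exact map_smul (M.ρ a) r m.1

theorem orbitMap_toMap {X Y : HeckeCat 𝓕} (f : X ⟶ Y) (m : fixedPoints M Y.sub)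
    (v : MonoidAlgebra ℤ (G ⧸ X.sub)) :
    orbitMap M m (HeckeCat.toMap f v) = orbitMap M (fixedPointsMap M f m) v := by
  induction v using MonoidAlgebra.induction_linear with
  | zero => simp
  | add a b ha hb => simp only [map_add, ha, hb]
  | single x z =>
    induction x using Quotient.inductionOn with
    | _ a =>
      have h : MonoidAlgebra.single (Quotient.mk _ a : G ⧸ X.sub) z = z • X.perm a X.gen := by
        rw [Representation.ofMulAction_single]
        simp [MonoidAlgebra.smul_single]
      rw [orbitMap_single, h, map_zsmul, map_zsmul,
        Representation.IntertwiningMap.isIntertwining, orbitMap_equivariant]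
      rfl

/-- The fixed point functor `M^- : G/H ↦ M^H`, as an `ℋ_𝓕`-module. -/
noncomputable def fixedPointFunctor (𝓕 : FiniteSubgroupFamily G) (M : Rep.{max u v} R G) :
    HeckeModule R 𝓕 :=
  ⟨{ obj := fun X => ModuleCat.of R (fixedPoints M X.unop.sub)
     map := fun f => ModuleCat.ofHom (fixedPointsMap M f.unop)
     map_id := fun X => by
       apply ModuleCat.hom_ext
       refine LinearMap.ext fun m => Subtype.ext ?_
       change orbitMap M m (HeckeCat.gen X.unop) = m.1
       rw [orbitMap_single, one_smul]
       change M.ρ 1 m.1 = m.1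
       simp
     map_comp := fun {X Y Z} f g => by
       apply ModuleCat.hom_ext
       refine LinearMap.ext fun m => Subtype.ext ?_
       exact orbitMap_toMap M f.unop m (HeckeCat.toMap g.unop (HeckeCat.gen Z.unop)) },
   ⟨fun {X Y f g} => by
     apply ModuleCat.hom_ext
     refine LinearMap.ext fun m => Subtype.ext ?_
     rw [ModuleCat.hom_add]
     exact map_add (orbitMap M m) (HeckeCat.toMap f.unop (HeckeCat.gen Y.unop))
       (HeckeCat.toMap g.unop (HeckeCat.gen Y.unop))⟩⟩

end FixedPoints

/-! ### The `ℋ_𝓕`-cohomological dimension -/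

/-- A resolution `⋯ ⟶ P₁ ⟶ P₀ ⟶ M ⟶ 0` of an `ℋ_𝓕`-module `M` by projective `ℋ_𝓕`-modules.
Exactness of a sequence of `ℋ_𝓕`-modules is exactness at every object. -/
structure HeckeProjectiveResolution {R : Type u} [CommRing R] {𝓕 : FiniteSubgroupFamily G}
    (M : HeckeModule R 𝓕) where
  /-- the modules of the resolution -/
  P : ℕ → HeckeModule R 𝓕
  projective : ∀ i, Projective (P i)
  /-- the differentials -/
  d : ∀ i, P (i + 1) ⟶ P i
  /-- the augmentation -/
  ε : P 0 ⟶ M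
  surjective_ε : ∀ X, Function.Surjective (ε.hom.app X).hom
  exact_zero : ∀ X, Function.Exact ((d 0).hom.app X).hom (ε.hom.app X).hom
  exact_succ : ∀ i X, Function.Exact ((d (i + 1)).hom.app X).hom ((d i).hom.app X).hom

/-- `R^-` has a resolution of length at most `n` by projective `ℋ_𝓕`-modules. -/
def HasHeckeResolution (R : Type u) [CommRing R] (𝓕 : FiniteSubgroupFamily G) (n : ℕ) : Prop :=
  ∃ C : HeckeProjectiveResolution (fixedPointFunctor 𝓕 (trivialRep R G)),
    ∀ i, n < i → ∀ X, Subsingleton ((C.P i).obj.obj X)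

/-- The `ℋ_𝓕`-cohomological dimension `ℋ_𝓕cd G` over `R`: the length of the shortest resolution of
the fixed point functor `R^-` by projective `ℋ_𝓕`-modules (`⊤` if there is none of finite
length). -/
noncomputable def HeckeCohomologicalDimension (R : Type u) [CommRing R]
    (𝓕 : FiniteSubgroupFamily G) : ℕ∞ :=
  sInf {N : ℕ∞ | ∃ n : ℕ, N = n ∧ HasHeckeResolution R 𝓕 n}

end Hecke

/-!
Both dimensions are read off from one complex, the bar complex `S` of the `G`-set `Δ`, with terms
`Sₙ = R[Δ^(n+1)]` and differential `d (x, y) = y - x × d y` (`barComplex`). The claim is that each of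
`𝓕cd G ≤ n` and `ℋ_𝓕cd G ≤ n` is equivalent to the following splitting of a boundary:

  there is an `RG`-linear map `h : Sₙ → Sₙ₊₁` with `d h d = d`, where `d : Sₙ₊₁ → Sₙ`.    (∗)

Each `Sₙ` is `𝓕`-projective, being a permutation module on a `G`-set over `Δ`
(`isFProjective_permRep`), and `S` is `𝓕`-split, since `H ∈ 𝓕` fixes the point `H` of `Δ`
(`barComplex_delta_splitsOver`). Moreover the fixed point functors `Sₙ^-` are projective
`ℋ_𝓕`-modules (`projective_fixedPoints_barComplex`): for `K ∈ 𝓕` the functor `R[G/K]^-` is free on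
one generator at `G/K`, because for the finite group `H` both `R[G/K]^H` and
`Hom(G/H, G/K) = ℤ[G/K]^H` have the sums of the `H`-orbits in `G/K` as a basis (`sigmaDesc`).

If `R` has an `𝓕`-split `𝓕`-projective resolution `P` of length `n`, then maps out of
`𝓕`-projectives lift against `𝓕`-split resolutions (`IsFProjective.exists_lift`), so there are
comparison maps `f : S → P`, `g : P → S` and a homotopy `h` from `f` followed by `g` to the identity.
As `P` vanishes in degree `n + 1`, the homotopy in degree `n` satisfies (∗)
(`AugComplex.exists_d_comp_d_eq`). If `R^-` has a projective resolution of length `n`, the same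
argument for `ℋ_𝓕`-modules gives `h : Sₙ^- → Sₙ₊₁^-`, whose value at the trivial subgroup is
`RG`-linear (`evalBot`) and satisfies (∗).

Conversely (∗) makes `1 - d h` an idempotent on `Sₙ` with kernel the image of `d`, so that replacing
`Sₙ` by the image of this idempotent and `Sᵢ`, for `i > n`, by zero yields an `𝓕`-split resolution of
length `n` by direct summands of the `Sᵢ` (`AugComplex.exists_truncation`). Its terms are
`𝓕`-projective, and its fixed points form a projective resolution of `R^-`, since contracting
homotopies over `H` preserve exactness on `H`-fixed points.
-/

/-! ### Comparison of augmented complexes -/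

/-- An augmented chain complex `⋯ ⟶ P₁ ⟶ P₀ ⟶ M` in a preadditive category. -/
structure AugComplex {C : Type*} [Category* C] [Preadditive C] (M : C) where
  /-- the objects -/
  P : ℕ → C
  /-- the differentials -/
  d : ∀ i, P (i + 1) ⟶ P i
  /-- the augmentation -/
  ε : P 0 ⟶ M
  d_ε : d 0 ≫ ε = 0
  d_d : ∀ i, d (i + 1) ≫ d i = 0

namespace AugComplex

variable {C : Type*} [Category* C] [Preadditive C] {M : C}

/-- `A` is projective relative to the augmented complex `Y`: every cycle with source `A` is a
boundary. -/
structure Lifts (A : C) (Y : AugComplex M) : Prop where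
  ε : ∀ a : A ⟶ M, ∃ b : A ⟶ Y.P 0, b ≫ Y.ε = a
  zero : ∀ a : A ⟶ Y.P 0, a ≫ Y.ε = 0 → ∃ b : A ⟶ Y.P 1, b ≫ Y.d 0 = a
  succ : ∀ i (a : A ⟶ Y.P (i + 1)), a ≫ Y.d i = 0 → ∃ b : A ⟶ Y.P (i + 2), b ≫ Y.d (i + 1) = a

/-- A comparison map between augmented complexes extends by one degree. -/
theorem Lifts.exists_comm {X Y : AugComplex M} {i : ℕ} (hL : Lifts (X.P (i + 2)) Y)
    (f : X.P (i + 1) ⟶ Y.P (i + 1)) (f' : X.P i ⟶ Y.P i) (h : f ≫ Y.d i = X.d i ≫ f') :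
    ∃ b : X.P (i + 2) ⟶ Y.P (i + 2), b ≫ Y.d (i + 1) = X.d (i + 1) ≫ f :=
  hL.succ i _ (by rw [Category.assoc, h, reassoc_of% X.d_d i, Limits.zero_comp])

/-- The inductive state of the simultaneous construction of comparison maps `f : X ⟶ Y`,
`g : Y ⟶ X` and of a homotopy from `f ≫ g` to the identity: in each degree only the fact that the
maps to be lifted in the next degree are cycles has to be remembered. -/
theorem exists_comparison (X Y : AugComplex M) (hXY : ∀ i, Lifts (X.P i) Y)
    (hYX : ∀ i, Lifts (Y.P i) X) (hXX : ∀ i, Lifts (X.P i) X) (n : ℕ) :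
    ∃ (f : X.P n ⟶ Y.P n) (g : Y.P n ⟶ X.P n) (h : X.P n ⟶ X.P (n + 1)),
      (∃ f' : X.P (n + 1) ⟶ Y.P (n + 1), f' ≫ Y.d n = X.d n ≫ f) ∧
      (∃ g' : Y.P (n + 1) ⟶ X.P (n + 1), g' ≫ X.d n = Y.d n ≫ g) ∧
      X.d n ≫ f ≫ g + X.d n ≫ h ≫ X.d n = X.d n := by
  induction n with
  | zero =>
    obtain ⟨f, hf⟩ := (hXY 0).ε X.ε
    obtain ⟨g, hg⟩ := (hYX 0).ε Y.ε
    obtain ⟨h, hh⟩ := (hXX 0).zero (𝟙 _ - f ≫ g) (by simp [hf, hg])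
    refine ⟨f, g, h, (hXY 1).zero _ (by simp [hf, X.d_ε]), (hYX 1).zero _ (by simp [hg, Y.d_ε]), ?_⟩
    rw [hh, Preadditive.comp_sub, Category.comp_id, add_sub_cancel]
  | succ n ih =>
    obtain ⟨f, g, h, ⟨f', hf⟩, ⟨g', hg⟩, H⟩ := ih
    obtain ⟨h', hh⟩ := (hXX (n + 1)).succ n (𝟙 _ - f' ≫ g' - X.d n ≫ h) (by
      simp only [Preadditive.sub_comp, Category.id_comp, Category.assoc, hg, reassoc_of% hf]
      rw [sub_sub, H, sub_self])
    refine ⟨f', g', h', (hXY _).exists_comm f' f hf, (hYX _).exists_comm g' g hg, ?_⟩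
    rw [hh]
    simp only [Preadditive.comp_sub, Category.comp_id]
    rw [reassoc_of% X.d_d n, Limits.zero_comp, sub_zero, add_sub_cancel]

/-- If `Y` vanishes in degree `n + 1`, then the image of `X.d n` is a direct summand of `X.P n`, in
the sense that `X.d n` is von Neumann regular. -/
theorem exists_d_comp_d_eq (X Y : AugComplex M) (hXY : ∀ i, Lifts (X.P i) Y)
    (hYX : ∀ i, Lifts (Y.P i) X) (hXX : ∀ i, Lifts (X.P i) X) (n : ℕ)
    (hY : Limits.IsZero (Y.P (n + 1))) :
    ∃ h : X.P n ⟶ X.P (n + 1), X.d n ≫ h ≫ X.d n = X.d n := by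
  obtain ⟨f, g, h, ⟨f', hf⟩, -, H⟩ := exists_comparison X Y hXY hYX hXX n
  rw [← reassoc_of% hf, hY.eq_of_tgt f' 0, Limits.zero_comp, zero_add] at H
  exact ⟨h, H⟩

end AugComplex

/-! ### Permutation modules and relative projectivity -/

section Permutation

variable {R : Type*} [CommRing R]

/-- The linear map `R[X] → V` extending a function on the basis `X`. -/
noncomputable def permLift {X V : Type*} [AddCommGroup V] [Module R V] (f : X → V) :
    MonoidAlgebra R X →ₗ[R] V :=
  Finsupp.linearCombination R f ∘ₗ (MonoidAlgebra.coeffLinearEquiv R).toLinearMap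

@[simp]
theorem permLift_single {X V : Type*} [AddCommGroup V] [Module R V] (f : X → V) (x : X) (r : R) :
    permLift f (MonoidAlgebra.single x r) = r • f x := by
  simp [permLift]

theorem single_eq_smul {X : Type*} (x : X) (r : R) :
    (MonoidAlgebra.single x r : MonoidAlgebra R X) = r • MonoidAlgebra.single x 1 := by
  simp [MonoidAlgebra.smul_single]

theorem permLinearMap_ext {X V : Type*} [AddCommGroup V] [Module R V]
    {f g : MonoidAlgebra R X →ₗ[R] V}
    (h : ∀ x, f (MonoidAlgebra.single x 1) = g (MonoidAlgebra.single x 1)) : f = g := by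
  refine LinearMap.ext fun v => ?_
  induction v using MonoidAlgebra.induction_linear with
  | zero => simp
  | add a b ha hb => simp only [map_add, ha, hb]
  | single x r => rw [single_eq_smul, map_smul, map_smul, h]

end Permutation

section Relative

variable {R : Type u} [CommRing R] {G : Type v} [Group G] {𝓕 : FiniteSubgroupFamily G}

/-- The permutation module `R[X]` of a `G`-set `X`. -/
noncomputable abbrev permRep (R : Type u) [CommRing R] (G : Type v) [Group G] (X : Type v)
    [MulAction G X] : Rep.{max u v} R G :=
  Rep.of (Representation.ofMulAction R G X)

/-- An intertwining map out of a permutation module, from an equivariant function on the basis. -/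
noncomputable def permIntertwining {H X V : Type*} [Group H] [MulAction H X] [AddCommGroup V]
    [Module R V] {ρ : Representation R H V} (f : X → V) (hf : ∀ (g : H) x, f (g • x) = ρ g (f x)) :
    (Representation.ofMulAction R H X).IntertwiningMap ρ where
  toLinearMap := permLift f
  isIntertwining' g := permLinearMap_ext fun x => by simp [hf]

@[simp]
theorem permIntertwining_single {H X V : Type*} [Group H] [MulAction H X] [AddCommGroup V]
    [Module R V] {ρ : Representation R H V} (f : X → V) (hf : ∀ (g : H) x, f (g • x) = ρ g (f x))
    (x : X) (r : R) : permIntertwining f hf (MonoidAlgebra.single x r) = r • f x :=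
  permLift_single f x r

theorem permIntertwining_ext {H X V : Type*} [Group H] [MulAction H X] [AddCommGroup V]
    [Module R V] {ρ : Representation R H V}
    {f g : (Representation.ofMulAction R H X).IntertwiningMap ρ}
    (h : ∀ x, f (MonoidAlgebra.single x 1) = g (MonoidAlgebra.single x 1)) : f = g :=
  Representation.IntertwiningMap.ext (permLinearMap_ext h)

/-- A `G`-set mapping to `Δ` has an `𝓕`-projective permutation module: `x ↦ x ⊗ π x` embeds `R[X]`
into `R[X] ⊗ RΔ`, with retraction `x ⊗ δ ↦ x`. -/
theorem isFProjective_permRep (X : Type v) [MulAction G X] (π : X → 𝓕.Delta)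
    (hπ : ∀ (g : G) x, π (g • x) = g • π x) : IsFProjective 𝓕 (permRep R G X) := by
  let aug : MonoidAlgebra R 𝓕.Delta →ₗ[R] R := permLift fun _ => 1
  let ι : X → MonoidAlgebra R X ⊗[R] MonoidAlgebra R 𝓕.Delta := fun x =>
    MonoidAlgebra.single x 1 ⊗ₜ MonoidAlgebra.single (π x) 1
  have hι : ∀ (g : G) x, ι (g • x) =
      (Representation.ofMulAction R G X).tprod (Representation.ofMulAction R G 𝓕.Delta) g (ι x) :=
    fun g x => by simp [ι, hπ, Representation.tprod_apply]
  refine ⟨permRep R G X, ⟨⟨Rep.ofHom (permIntertwining ι hι), Rep.ofHom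
      ⟨(TensorProduct.rid R _).toLinearMap ∘ₗ TensorProduct.map LinearMap.id aug, ?_⟩, ?_⟩⟩⟩
  · intro g
    have h : aug ∘ₗ Representation.ofMulAction R G 𝓕.Delta g = aug :=
      permLinearMap_ext fun x => by simp [aug]
    refine TensorProduct.ext' fun a b => ?_
    have h' := LinearMap.congr_fun h b
    simp only [LinearMap.comp_apply] at h'
    simp [Representation.tprod_apply, h']
  · apply Rep.hom_ext
    refine permIntertwining_ext fun x => ?_
    change (TensorProduct.rid R _) (TensorProduct.map LinearMap.id aug
      (permIntertwining ι hι (MonoidAlgebra.single x 1))) = MonoidAlgebra.single x 1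
    simp [ι, aug]

theorem IsFProjective.of_retract {P Q : Rep.{max u v} R G} (hQ : IsFProjective 𝓕 Q)
    (r : Retract P Q) : IsFProjective 𝓕 P := by
  obtain ⟨N, ⟨r'⟩⟩ := hQ
  exact ⟨N, ⟨r.trans r'⟩⟩

section Lifting

variable {Y Y' : Rep.{max u v} R G}

/-- For an `RH`-linear map `s : Y → Y'` and a coset `gH`, the conjugate `g s g⁻¹`. -/
noncomputable def cosetConj {H : Subgroup G}
    (s : (restrictRep Y H).IntertwiningMap (restrictRep Y' H)) : G ⧸ H → (Y →ₗ[R] Y') :=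
  Quotient.lift (fun g : G => Y'.ρ g ∘ₗ s.toLinearMap ∘ₗ Y.ρ g⁻¹) (by
    intro a b hab
    have h : a⁻¹ * b ∈ H := QuotientGroup.leftRel_apply.mp hab
    have hs : s.toLinearMap ∘ₗ Y.ρ (a⁻¹ * b) = Y'.ρ (a⁻¹ * b) ∘ₗ s.toLinearMap :=
      s.isIntertwining' ⟨_, h⟩
    have hb : b⁻¹ = (a⁻¹ * b)⁻¹ * a⁻¹ := by group
    refine LinearMap.ext fun y => ?_
    have h1 := LinearMap.congr_fun hs (Y.ρ b⁻¹ y)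
    simp only [LinearMap.comp_apply, ← Module.End.mul_apply, ← map_mul] at h1 ⊢
    simp only [mul_assoc, mul_inv_cancel, mul_one] at h1
    rw [h1, ← Module.End.mul_apply, ← map_mul, mul_inv_cancel_left])

theorem cosetConj_smul {H : Subgroup G}
    (s : (restrictRep Y H).IntertwiningMap (restrictRep Y' H)) (g : G) (x : G ⧸ H) (y : Y) :
    cosetConj s (g • x) (Y.ρ g y) = Y'.ρ g (cosetConj s x y) := by
  induction x using Quotient.inductionOn with
  | _ a =>
    change Y'.ρ (g * a) (s (Y.ρ (g * a)⁻¹ (Y.ρ g y))) = Y'.ρ g (Y'.ρ a (s (Y.ρ a⁻¹ y)))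
    simp only [← Module.End.mul_apply, ← map_mul]
    simp [mul_inv_rev]

/-- Lifting against a map `d : Y' ⟶ Y` that admits, for each `H ∈ 𝓕`, an `RH`-linear section over
the image of `a`: on `N ⊗ RΔ` the lift of `a` is `n ⊗ gH ↦ g s_H (g⁻¹ a (n ⊗ gH))`. -/
theorem IsFProjective.exists_lift {P : Rep.{max u v} R G} (hP : IsFProjective 𝓕 P) (d : Y' ⟶ Y)
    (a : P ⟶ Y) (hs : ∀ H ∈ 𝓕.carrier,
      ∃ s : (restrictRep Y H).IntertwiningMap (restrictRep Y' H),
        ∀ p, d.hom (s (a.hom p)) = a.hom p) :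
    ∃ b : P ⟶ Y', b ≫ d = a := by
  obtain ⟨N, ⟨r⟩⟩ := hP
  choose s hs using hs
  let a' := r.r ≫ a
  let T : 𝓕.Delta → (Y →ₗ[R] Y') := fun δ => cosetConj (s δ.1.1 δ.1.2) δ.2
  have hT : ∀ (g : G) δ y, T (g • δ) (Y.ρ g y) = Y'.ρ g (T δ y) := fun g δ y =>
    cosetConj_smul _ g δ.2 y
  have hd : ∀ δ p, d.hom (T δ (a.hom p)) = a.hom p := by
    rintro ⟨H, x⟩ p
    induction x using Quotient.inductionOn with
    | _ g =>
      change d.hom (Y'.ρ g (s H.1 H.2 (Y.ρ g⁻¹ (a.hom p)))) = _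
      rw [Rep.hom_comm_apply, ← Rep.hom_comm_apply a, hs, ← Rep.hom_comm_apply a,
        ← Module.End.mul_apply, ← map_mul]
      simp
  let b : N ⊗[R] MonoidAlgebra R 𝓕.Delta →ₗ[R] Y' := TensorProduct.lift (LinearMap.flip
    (permLift fun δ => T δ ∘ₗ a'.hom.toLinearMap ∘ₗ
      (TensorProduct.mk R N _).flip (MonoidAlgebra.single δ 1)))
  have hb : ∀ n δ, b (n ⊗ₜ MonoidAlgebra.single δ 1) =
      T δ (a'.hom (n ⊗ₜ MonoidAlgebra.single δ 1)) := fun n δ => by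
    simp [b]
  have hext : ∀ {V : Type (max u v)} [AddCommGroup V] [Module R V]
      {f f' : N ⊗[R] MonoidAlgebra R 𝓕.Delta →ₗ[R] V}, (∀ n δ,
        f (n ⊗ₜ MonoidAlgebra.single δ 1) = f' (n ⊗ₜ MonoidAlgebra.single δ 1)) → f = f' := by
    intro V _ _ f f' h
    refine TensorProduct.ext (LinearMap.ext fun n => permLinearMap_ext fun δ => h n δ)
  let b' : Rep.of (N.ρ.tprod (Representation.ofMulAction R G 𝓕.Delta)) ⟶ Y' := Rep.ofHom ⟨b, by
    refine fun g => hext fun n δ => ?_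
    have h := Rep.hom_comm_apply a' g (n ⊗ₜ MonoidAlgebra.single δ 1)
    simp only [Representation.tprod_apply, TensorProduct.map_tmul,
      Representation.ofMulAction_single] at h
    simp only [LinearMap.comp_apply, Representation.tprod_apply, TensorProduct.map_tmul,
      Representation.ofMulAction_single, hb]
    rw [h, hT]⟩
  have hbd : b' ≫ d = a' := by
    apply Rep.hom_ext
    refine Representation.IntertwiningMap.ext (hext fun n δ => ?_)
    exact (congrArg d.hom (hb n δ)).trans (hd δ _)
  exact ⟨r.i ≫ b', by rw [Category.assoc, hbd, ← Category.assoc, r.retract, Category.id_comp]⟩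

end Lifting

/-- The augmented complex splits over `H`: it has an `RH`-linear contracting homotopy. -/
def AugComplex.SplitsOver {M : Rep.{max u v} R G} (X : AugComplex M) (H : Subgroup G) : Prop :=
  ∃ (t : (restrictRep M H).IntertwiningMap (restrictRep (X.P 0) H))
    (s : ∀ i, (restrictRep (X.P i) H).IntertwiningMap (restrictRep (X.P (i + 1)) H)),
    (∀ m, X.ε.hom (t m) = m) ∧
    (∀ x, (X.d 0).hom (s 0 x) + t (X.ε.hom x) = x) ∧
    (∀ i x, (X.d (i + 1)).hom (s (i + 1) x) + s i ((X.d i).hom x) = x)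

/-- `𝓕`-projective modules are projective relative to `𝓕`-split augmented complexes. -/
theorem IsFProjective.lifts {P M : Rep.{max u v} R G} (hP : IsFProjective 𝓕 P)
    (X : AugComplex M) (hX : ∀ H ∈ 𝓕.carrier, X.SplitsOver H) : AugComplex.Lifts P X where
  ε a := hP.exists_lift X.ε a fun H hH => by
    obtain ⟨t, -, h, -⟩ := hX H hH
    exact ⟨t, fun p => h _⟩
  zero a ha := hP.exists_lift (X.d 0) a fun H hH => by
    obtain ⟨t, s, -, h, -⟩ := hX H hH
    refine ⟨s 0, fun p => ?_⟩
    have h0 : X.ε.hom (a.hom p) = 0 := congrArg (fun f => f.hom p) ha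
    have := h (a.hom p)
    rwa [h0, map_zero, add_zero] at this
  succ i a ha := hP.exists_lift (X.d (i + 1)) a fun H hH => by
    obtain ⟨t, s, -, -, h⟩ := hX H hH
    refine ⟨s (i + 1), fun p => ?_⟩
    have h0 : (X.d i).hom (a.hom p) = 0 := congrArg (fun f => f.hom p) ha
    have := h i (a.hom p)
    rwa [h0, map_zero, add_zero] at this

/-- The augmented complex underlying a resolution. -/
noncomputable def RepResolution.aug {M : Rep.{max u v} R G} (C : RepResolution M) :
    AugComplex M where
  P := C.P
  d := C.d
  ε := C.ε
  d_ε := Rep.hom_ext <| Representation.IntertwiningMap.ext <| LinearMap.ext fun x =>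
    (C.exact_zero _).2 ⟨x, rfl⟩
  d_d i := Rep.hom_ext <| Representation.IntertwiningMap.ext <| LinearMap.ext fun x =>
    (C.exact_succ i _).2 ⟨x, rfl⟩

/-- An augmented complex that splits over some subgroup is a resolution. -/
noncomputable def AugComplex.toRepResolution {M : Rep.{max u v} R G} (X : AugComplex M)
    (H : Subgroup G) (hX : X.SplitsOver H) : RepResolution M where
  P := X.P
  d := X.d
  ε := X.ε
  surjective_ε m := by
    obtain ⟨t, -, h, -⟩ := hX
    exact ⟨t m, h m⟩
  exact_zero x := by
    obtain ⟨t, s, -, h, -⟩ := hX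
    refine ⟨fun hx => ⟨s 0 x, ?_⟩, ?_⟩
    · have := h x
      rwa [hx, map_zero, add_zero] at this
    · rintro ⟨y, rfl⟩
      exact congrArg (fun f => f.hom y) X.d_ε
  exact_succ i x := by
    obtain ⟨t, s, -, -, h⟩ := hX
    refine ⟨fun hx => ⟨s (i + 1) x, ?_⟩, ?_⟩
    · have := h i x
      rwa [hx, map_zero, add_zero] at this
    · rintro ⟨y, rfl⟩
      exact congrArg (fun f => f.hom y) (X.d_d i)

end Relative

/-! ### Truncation at a split boundary -/

namespace AugComplex

section Idempotents

variable {C : Type*} [Category* C] [Preadditive C] {M : C} (X : AugComplex M) (n : ℕ)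
  (k : ∀ i, X.P i ⟶ X.P (i + 1))

/-- The idempotent endomorphisms cutting out the truncation of `X` in degree `n`: the identity below
`n`, a projection with kernel the boundaries in degree `n`, and zero above. -/
noncomputable def truncIdem (i : ℕ) : X.P i ⟶ X.P i :=
  if i < n then 𝟙 _ else if i = n then 𝟙 _ - k i ≫ X.d i else 0

variable {n k}

theorem truncIdem_of_lt {i : ℕ} (h : i < n) : X.truncIdem n k i = 𝟙 _ := if_pos h

theorem truncIdem_self : X.truncIdem n k n = 𝟙 _ - k n ≫ X.d n := by
  simp [truncIdem]

theorem truncIdem_of_gt {i : ℕ} (h : n < i) : X.truncIdem n k i = 0 := by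
  simp [truncIdem, h.not_gt, h.ne']

variable (hk : X.d n ≫ k n ≫ X.d n = X.d n)
include hk

theorem truncIdem_idem (i : ℕ) : X.truncIdem n k i ≫ X.truncIdem n k i = X.truncIdem n k i := by
  rcases lt_trichotomy i n with h | rfl | h
  · simp [X.truncIdem_of_lt h]
  · simp [truncIdem_self, hk]
  · simp [X.truncIdem_of_gt h]

theorem truncIdem_d_truncIdem (i : ℕ) :
    X.truncIdem n k (i + 1) ≫ X.d i ≫ X.truncIdem n k i = X.d i ≫ X.truncIdem n k i := by
  rcases lt_trichotomy i n with h | rfl | h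
  · rw [X.truncIdem_of_lt h, Category.comp_id]
    rcases (Nat.succ_le_of_lt h).lt_or_eq with h' | rfl
    · rw [X.truncIdem_of_lt h', Category.id_comp]
    · simp [truncIdem_self, X.d_d]
  · simp [truncIdem_self, hk]
  · simp [X.truncIdem_of_gt h]

theorem truncIdem_ε : X.truncIdem n k 0 ≫ X.ε = X.ε := by
  rcases n.eq_zero_or_pos with rfl | h
  · simp [truncIdem_self, X.d_ε]
  · simp [X.truncIdem_of_lt h]

end Idempotents

variable {R : Type u} [CommRing R] {G : Type v} [Group G]

/-- If the boundary `X.d n` is von Neumann regular, then `X` can be truncated in degree `n` by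
direct summands of its terms, and contracting homotopies restrict to the truncation. -/
theorem exists_truncation {M : Rep.{max u v} R G} (X : AugComplex M) (n : ℕ)
    (h : X.P n ⟶ X.P (n + 1)) (hh : X.d n ≫ h ≫ X.d n = X.d n) :
    ∃ X' : AugComplex M, (∀ i, Nonempty (Retract (X'.P i) (X.P i))) ∧
      (∀ H, X.SplitsOver H → X'.SplitsOver H) ∧ ∀ i, n < i → Subsingleton (X'.P i) := by
  let k : ∀ i, X.P i ⟶ X.P (i + 1) := Function.update (fun _ => 0) n h
  have hk : X.d n ≫ k n ≫ X.d n = X.d n := by simpa [k] using hh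
  have key := fun i => IsIdempotentComplete.idempotents_split (X.P i) (X.truncIdem n k i)
    (X.truncIdem_idem hk i)
  choose P ι π hιπ hπι using key
  have hπ : ∀ i, X.truncIdem n k i ≫ π i = π i := fun i => by
    rw [← hπι, Category.assoc, hιπ, Category.comp_id]
  have hd : ∀ i, X.truncIdem n k (i + 1) ≫ X.d i ≫ π i = X.d i ≫ π i := fun i => by
    rw [← hπ i, reassoc_of% X.truncIdem_d_truncIdem hk i]
  refine ⟨⟨P, fun i => ι (i + 1) ≫ X.d i ≫ π i, ι 0 ≫ X.ε, ?_, fun i => ?_⟩, fun i => ?_, ?_, ?_⟩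
  · simp only [Category.assoc]
    rw [reassoc_of% hπι 0, X.truncIdem_ε hk, X.d_ε, Limits.comp_zero]
  · simp only [Category.assoc]
    rw [reassoc_of% hπι (i + 1), hd, reassoc_of% X.d_d i, Limits.zero_comp, Limits.comp_zero]
  · exact ⟨⟨ι i, π i, hιπ i⟩⟩
  · rintro H ⟨t, s, h₁, h₂, h₃⟩
    have eπι : ∀ i x, (ι i).hom ((π i).hom x) = (X.truncIdem n k i).hom x := fun i x =>
      congrArg (fun f => f.hom x) (hπι i)
    have eιπ : ∀ i x, (π i).hom ((ι i).hom x) = x := fun i x =>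
      congrArg (fun f => f.hom x) (hιπ i)
    have ed : ∀ i x, (π i).hom ((X.d i).hom ((X.truncIdem n k (i + 1)).hom x)) =
        (π i).hom ((X.d i).hom x) := fun i x => congrArg (fun f => f.hom x) (hd i)
    have eε : ∀ x, X.ε.hom ((X.truncIdem n k 0).hom x) = X.ε.hom x := fun x =>
      congrArg (fun f => f.hom x) (X.truncIdem_ε hk)
    -- the homotopy preserves the kernel of the projection to the truncation
    have es : ∀ i x, (π (i + 1)).hom (s i ((X.truncIdem n k i).hom x)) =
        (π (i + 1)).hom (s i x) := fun i x => by
      rcases lt_or_ge i n with h | h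
      · rw [X.truncIdem_of_lt h]; rfl
      · have : π (i + 1) = 0 := by
          rw [← hπ, X.truncIdem_of_gt (Nat.lt_succ_of_le h), Limits.zero_comp]
        rw [this]; rfl
    let res : ∀ {A B : Rep.{max u v} R G}, (A ⟶ B) →
        (restrictRep A H).IntertwiningMap (restrictRep B H) := fun f =>
      ⟨f.hom.toLinearMap, fun g => f.hom.isIntertwining' g.1⟩
    refine ⟨(res (π 0)).comp t, fun i => (res (π (i + 1))).comp ((s i).comp (res (ι i))),
      fun m => ?_, fun x => ?_, fun i x => ?_⟩
    · change X.ε.hom ((ι 0).hom ((π 0).hom (t m))) = m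
      rw [eπι, eε, h₁]
    · change (π 0).hom ((X.d 0).hom ((ι 1).hom ((π 1).hom (s 0 ((ι 0).hom x))))) +
        (π 0).hom (t (X.ε.hom ((ι 0).hom x))) = x
      rw [eπι, ed, ← map_add, h₂, eιπ]
    · change (π (i + 1)).hom ((X.d (i + 1)).hom ((ι (i + 2)).hom ((π (i + 2)).hom
        (s (i + 1) ((ι (i + 1)).hom x))))) + (π (i + 1)).hom (s i ((ι i).hom ((π i).hom
        ((X.d i).hom ((ι (i + 1)).hom x))))) = x
      rw [eπι, ed, eπι, es, ← map_add, h₃, eιπ]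
  · intro i hi
    refine (Rep.isZero_iff _ _ _).1 ((Limits.IsZero.iff_id_eq_zero _).2 ?_)
    change 𝟙 (P i) = 0
    rw [← hιπ, ← hπ, X.truncIdem_of_gt hi, Limits.zero_comp, Limits.comp_zero]

end AugComplex

/-! ### The bar resolution of a `G`-set -/

section Bar

variable (R : Type u) [CommRing R] (X : Type v)

/-- Left concatenation with `x`, as a linear map `R[X ^ n] → R[X ^ (n + 1)]`. -/
noncomputable def barCons (x : X) (n : ℕ) :
    MonoidAlgebra R (Fin n → X) →ₗ[R] MonoidAlgebra R (Fin (n + 1) → X) :=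
  permLift fun y => MonoidAlgebra.single (Fin.cons x y) 1

/-- The bar differential `R[X ^ (n + 1)] → R[X ^ n]`, given recursively by
`d (x, y) = y - x × d y`. -/
noncomputable def barD :
    ∀ n, MonoidAlgebra R (Fin (n + 1) → X) →ₗ[R] MonoidAlgebra R (Fin n → X)
  | 0 => permLift fun p => MonoidAlgebra.single (Fin.tail p) 1
  | n + 1 => permLift fun p => MonoidAlgebra.single (Fin.tail p) 1 -
      barCons R X (p 0) n (barD n (MonoidAlgebra.single (Fin.tail p) 1))

/-- The isomorphism `R[X ^ 0] → R`. -/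
noncomputable def barPoint : MonoidAlgebra R (Fin 0 → X) →ₗ[R] ULift.{v} R :=
  permLift fun _ => ⟨1⟩

variable {R X}

@[simp]
theorem barCons_single (x : X) (n : ℕ) (y : Fin n → X) :
    barCons R X x n (MonoidAlgebra.single y 1) = MonoidAlgebra.single (Fin.cons x y) 1 := by
  simp [barCons]

theorem barD_zero_single (p : Fin 1 → X) :
    barD R X 0 (MonoidAlgebra.single p 1) = MonoidAlgebra.single (Fin.tail p) 1 := by
  simp [barD]

theorem barD_succ_single (n : ℕ) (p : Fin (n + 2) → X) :
    barD R X (n + 1) (MonoidAlgebra.single p 1) = MonoidAlgebra.single (Fin.tail p) 1 -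
      barCons R X (p 0) n (barD R X n (MonoidAlgebra.single (Fin.tail p) 1)) := by
  simp [barD]

theorem barD_zero_cons (x : X) (v : MonoidAlgebra R (Fin 0 → X)) :
    barD R X 0 (barCons R X x 0 v) = v := by
  suffices h : barD R X 0 ∘ₗ barCons R X x 0 = LinearMap.id from LinearMap.congr_fun h v
  refine permLinearMap_ext fun y => ?_
  rw [LinearMap.comp_apply, barCons_single, barD_zero_single, Fin.tail_cons, LinearMap.id_apply]

theorem barD_succ_cons (x : X) (n : ℕ) (v : MonoidAlgebra R (Fin (n + 1) → X)) :
    barD R X (n + 1) (barCons R X x (n + 1) v) = v - barCons R X x n (barD R X n v) := by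
  suffices h : barD R X (n + 1) ∘ₗ barCons R X x (n + 1) =
      LinearMap.id - barCons R X x n ∘ₗ barD R X n from LinearMap.congr_fun h v
  refine permLinearMap_ext fun y => ?_
  rw [LinearMap.comp_apply, barCons_single, barD_succ_single, Fin.tail_cons, Fin.cons_zero]
  rfl

theorem barD_barD (n : ℕ) (v : MonoidAlgebra R (Fin (n + 2) → X)) :
    barD R X n (barD R X (n + 1) v) = 0 := by
  suffices h : ∀ n, barD R X n ∘ₗ barD R X (n + 1) = 0 from LinearMap.congr_fun (h n) v
  intro n
  induction n with
  | zero =>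
    refine permLinearMap_ext fun p => ?_
    rw [LinearMap.comp_apply, barD_succ_single, map_sub, barD_zero_cons, sub_self,
      LinearMap.zero_apply]
  | succ n ih =>
    refine permLinearMap_ext fun p => ?_
    have h := LinearMap.congr_fun ih (MonoidAlgebra.single (Fin.tail p) 1)
    rw [LinearMap.comp_apply, LinearMap.zero_apply] at h
    rw [LinearMap.comp_apply, barD_succ_single, map_sub, barD_succ_cons, h, map_zero, sub_zero,
      sub_self, LinearMap.zero_apply]

theorem barPoint_smul_single (v : MonoidAlgebra R (Fin 0 → X)) :
    (barPoint R X v).down • MonoidAlgebra.single default 1 = v := by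
  suffices h : (LinearMap.toSpanSingleton R _ (MonoidAlgebra.single default 1) ∘ₗ
      ULift.moduleEquiv.toLinearMap) ∘ₗ barPoint R X = LinearMap.id from LinearMap.congr_fun h v
  refine permLinearMap_ext fun y => ?_
  rw [Subsingleton.elim y default]
  simp [barPoint]

variable {G : Type v} [Group G] [MulAction G X]

theorem barCons_smul (g : G) (x : X) (n : ℕ) (v : MonoidAlgebra R (Fin n → X)) :
    barCons R X (g • x) n (Representation.ofMulAction R G (Fin n → X) g v) =
      Representation.ofMulAction R G (Fin (n + 1) → X) g (barCons R X x n v) := by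
  suffices h : barCons R X (g • x) n ∘ₗ Representation.ofMulAction R G (Fin n → X) g =
      Representation.ofMulAction R G (Fin (n + 1) → X) g ∘ₗ barCons R X x n from
    LinearMap.congr_fun h v
  refine permLinearMap_ext fun y => ?_
  simp only [LinearMap.comp_apply, Representation.ofMulAction_single, barCons_single]
  congr 1
  exact funext fun i => by cases i using Fin.cases <;> rfl

theorem barD_smul (g : G) (n : ℕ) :
    barD R X n ∘ₗ Representation.ofMulAction R G (Fin (n + 1) → X) g =
      Representation.ofMulAction R G (Fin n → X) g ∘ₗ barD R X n := by
  induction n with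
  | zero =>
    refine permLinearMap_ext fun p => ?_
    simp only [LinearMap.comp_apply, Representation.ofMulAction_single, barD_zero_single]
    rfl
  | succ n ih =>
    refine permLinearMap_ext fun p => ?_
    have h := LinearMap.congr_fun ih (MonoidAlgebra.single (Fin.tail p) 1)
    simp only [LinearMap.comp_apply, Representation.ofMulAction_single] at h
    simp only [LinearMap.comp_apply, Representation.ofMulAction_single, barD_succ_single, map_sub,
      ← barCons_smul, ← h]
    rfl

variable (R X G)

/-- The bar complex `⋯ → R[X × X] → R[X] → R` of a `G`-set `X`. -/
noncomputable def barComplex : AugComplex (trivialRep R G) where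
  P n := permRep R G (Fin (n + 1) → X)
  d n := Rep.ofHom ⟨barD R X (n + 1), fun g => barD_smul g (n + 1)⟩
  ε := Rep.ofHom ⟨barPoint R X ∘ₗ barD R X 0, fun g => by
    rw [LinearMap.comp_assoc, barD_smul]
    exact permLinearMap_ext fun p => by simp [barD_zero_single, barPoint]⟩
  d_ε := Rep.hom_ext <| Representation.IntertwiningMap.ext <| LinearMap.ext fun v =>
    (congrArg (barPoint R X) (barD_barD 0 v)).trans (map_zero _)
  d_d n := Rep.hom_ext <| Representation.IntertwiningMap.ext <| LinearMap.ext (barD_barD (n + 1))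

variable {R X G}

/-- Concatenation with an `H`-fixed point is an `RH`-linear contraction of the bar complex. -/
theorem barComplex_splitsOver (H : Subgroup G) (x : X) (hx : ∀ h ∈ H, h • x = x) :
    (barComplex R X G).SplitsOver H := by
  have hcons : ∀ (n : ℕ) (h : H) (v : MonoidAlgebra R (Fin n → X)),
      barCons R X x n (Representation.ofMulAction R G (Fin n → X) h.1 v) =
        Representation.ofMulAction R G (Fin (n + 1) → X) h.1 (barCons R X x n v) := fun n h v => by
    rw [← barCons_smul, hx _ h.2]
  refine ⟨⟨barCons R X x 0 ∘ₗ LinearMap.toSpanSingleton R _ (MonoidAlgebra.single default 1) ∘ₗ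
    ULift.moduleEquiv.toLinearMap, fun h => LinearMap.ext fun r => ?_⟩,
    fun n => ⟨barCons R X x (n + 1), fun h => LinearMap.ext (hcons (n + 1) h)⟩,
    fun r => ?_, fun v => ?_, fun n v => ?_⟩
  · change barCons R X x 0 (r.down • _) =
      Representation.ofMulAction R G (Fin 1 → X) h.1 (barCons R X x 0 (r.down • _))
    rw [← hcons, map_smul (Representation.ofMulAction R G (Fin 0 → X) h.1),
      Representation.ofMulAction_single, Subsingleton.elim (h.1 • default) default]
  · change barPoint R X (barD R X 0 (barCons R X x 0 (r.down • _))) = r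
    rw [barD_zero_cons, map_smul]
    exact ULift.ext _ _ (by simp [barPoint])
  · change MonoidAlgebra R (Fin 1 → X) at v
    change barD R X 1 (barCons R X x 1 v) +
      barCons R X x 0 ((barPoint R X (barD R X 0 v)).down • _) = v
    rw [barD_succ_cons, barPoint_smul_single, sub_add_cancel]
  · change MonoidAlgebra R (Fin (n + 2) → X) at v
    change barD R X (n + 2) (barCons R X x (n + 2) v) +
      barCons R X x (n + 1) (barD R X (n + 1) v) = v
    rw [barD_succ_cons, sub_add_cancel]

variable (𝓕 : FiniteSubgroupFamily G)

theorem barComplex_delta_splitsOver (H : Subgroup G) (hH : H ∈ 𝓕.carrier) :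
    (barComplex R 𝓕.Delta G).SplitsOver H := by
  refine barComplex_splitsOver H ⟨⟨H, hH⟩, ((1 : G) : G ⧸ H)⟩ fun h hh => ?_
  refine Sigma.ext rfl (heq_of_eq ?_)
  exact QuotientGroup.eq.mpr (by simpa using hh)

theorem isFProjective_barComplex (n : ℕ) :
    IsFProjective 𝓕 ((barComplex R 𝓕.Delta G).P n) :=
  isFProjective_permRep (Fin (n + 1) → 𝓕.Delta) (fun y => y 0) fun _ _ => rfl

/-- An `𝓕`-split `𝓕`-projective resolution of length `n` makes the `n`-th boundary of the bar
complex split. -/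
theorem HasFResolution.exists_barComplex_d_comp_d {n : ℕ} (h : HasFResolution R 𝓕 n) :
    ∃ k : (barComplex R 𝓕.Delta G).P n ⟶ (barComplex R 𝓕.Delta G).P (n + 1),
      (barComplex R 𝓕.Delta G).d n ≫ k ≫ (barComplex R 𝓕.Delta G).d n =
        (barComplex R 𝓕.Delta G).d n := by
  obtain ⟨C, hP, hS, h0⟩ := h
  exact AugComplex.exists_d_comp_d_eq _ C.aug
    (fun i => (isFProjective_barComplex 𝓕 i).lifts _ hS)
    (fun i => (hP i).lifts _ (barComplex_delta_splitsOver 𝓕))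
    (fun i => (isFProjective_barComplex 𝓕 i).lifts _ (barComplex_delta_splitsOver 𝓕)) n
    ((Rep.isZero_iff _ _ _).2 (h0 _ n.lt_succ_self))

end Bar

/-! ### Invariants of permutation modules of finite groups -/

section OrbitSums

variable (A : Type*) [CommRing A] (H : Type*) [Group H] {Y : Type*} [MulAction H Y]

/-- The sum of the elements of the `H`-orbit of `y`. -/
noncomputable def orbitSum (y : Y) : MonoidAlgebra A Y :=
  ∑ᶠ z ∈ MulAction.orbit H y, MonoidAlgebra.single z 1

theorem finite_orbit [Finite H] (y : Y) : (MulAction.orbit H y).Finite := Set.finite_range _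

theorem orbitSum_eq_of_mem {y z : Y} (h : z ∈ MulAction.orbit H y) :
    orbitSum A H z = orbitSum A H y := by
  rw [orbitSum, MulAction.orbit_eq_iff.2 h, orbitSum]

theorem map_orbitSum [Finite H] {B V : Type*} [AddCommMonoid V] [CommRing B]
    (f : MonoidAlgebra B Y →+ V) (y : Y) :
    f (orbitSum B H y) = ∑ᶠ z ∈ MulAction.orbit H y, f (MonoidAlgebra.single z 1) :=
  f.map_finsum_mem _ (finite_orbit H y)

open scoped Classical in
theorem coeff_orbitSum [Finite H] (y z : Y) :
    (orbitSum A H y).coeff z = if z ∈ MulAction.orbit H y then 1 else 0 := by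
  rw [orbitSum, finsum_mem_eq_finite_toFinset_sum _ (finite_orbit H y), MonoidAlgebra.coeff_sum,
    Finsupp.finsetSum_apply]
  simp [MonoidAlgebra.coeff_single, Finsupp.single_apply]

theorem ofMulAction_orbitSum [Finite H] (y : Y) (h : H) :
    Representation.ofMulAction A H Y h (orbitSum A H y) = orbitSum A H y := by
  ext z
  rw [Representation.coeff_ofMulAction, coeff_orbitSum, coeff_orbitSum]
  rw [← MulAction.orbit_eq_iff, MulAction.orbit_smul, MulAction.orbit_eq_iff]

/-- The coefficients of an element of `A[Y]` at chosen representatives of the `H`-orbits. -/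
noncomputable def orbitCoeff :
    MonoidAlgebra A Y →ₗ[A] (MulAction.orbitRel.Quotient H Y →₀ A) :=
  Finsupp.lcomapDomain Quotient.out Quotient.out_injective ∘ₗ
    (MonoidAlgebra.coeffLinearEquiv A).toLinearMap

theorem orbitCoeff_orbitSum [Finite H] (y : Y) :
    orbitCoeff A H (orbitSum A H y) = Finsupp.single (Quotient.mk _ y) 1 := by
  classical
  ext q
  change (orbitSum A H y).coeff q.out = _
  rw [coeff_orbitSum, Finsupp.single_apply]
  congr 1
  rw [← MulAction.orbitRel_apply, ← Quotient.eq (r := MulAction.orbitRel H Y), Quotient.out_eq]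
  exact propext eq_comm

variable {A H}

theorem coeff_smul_of_invariant {u : MonoidAlgebra A Y}
    (hu : ∀ h : H, Representation.ofMulAction A H Y h u = u) (h : H) (y : Y) :
    u.coeff (h • y) = u.coeff y := by
  conv_lhs => rw [← hu h]
  rw [Representation.coeff_ofMulAction, inv_smul_smul]

/-- An invariant element is the linear combination of the orbit sums given by its coefficients. -/
theorem eq_linearCombination_orbitSum [Finite H] {u : MonoidAlgebra A Y}
    (hu : ∀ h : H, Representation.ofMulAction A H Y h u = u) :
    u = Finsupp.linearCombination A
      (fun q : MulAction.orbitRel.Quotient H Y => orbitSum A H q.out) (orbitCoeff A H u) := by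
  classical
  ext y
  obtain ⟨h, hh⟩ : (Quotient.mk (MulAction.orbitRel H Y) y).out ∈ MulAction.orbit H y :=
    (MulAction.orbitRel_apply).1 (Quotient.mk_out (s := MulAction.orbitRel H Y) y)
  have key : ∀ q : MulAction.orbitRel.Quotient H Y,
      (orbitSum A H q.out).coeff y = if q = Quotient.mk _ y then 1 else 0 := fun q => by
    rw [coeff_orbitSum]
    congr 1
    rw [← MulAction.orbitRel_apply, ← Quotient.eq (r := MulAction.orbitRel H Y), Quotient.out_eq]
    exact propext eq_comm
  rw [Finsupp.linearCombination_apply, Finsupp.sum, MonoidAlgebra.coeff_sum,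
    Finsupp.finsetSum_apply]
  simp only [MonoidAlgebra.coeff_smul, Finsupp.smul_apply, key, smul_eq_mul, mul_ite, mul_one,
    mul_zero, Finset.sum_ite_eq']
  have h2 : orbitCoeff A H u (Quotient.mk _ y) = u.coeff y := by
    change u.coeff (Quotient.mk (MulAction.orbitRel H Y) y).out = _
    rw [← hh]
    exact coeff_smul_of_invariant hu h y
  split_ifs with h3
  · exact h2.symm
  · rw [← h2, Finsupp.notMem_support_iff.1 h3]

end OrbitSums

/-! ### Epimorphisms and lifting for additive functors -/

section AdditiveFunctors

variable {C : Type*} [Category* C] [Preadditive C] {R : Type*} [CommRing R]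

/-- The pointwise cokernel of a morphism of additive functors. -/
noncomputable def pointwiseCoker {F F' : C ⥤+ ModuleCat.{v} R} (f : F ⟶ F') :
    C ⥤+ ModuleCat.{v} R :=
  ⟨{ obj := fun X => ModuleCat.of R (F'.obj.obj X ⧸ LinearMap.range (f.hom.app X).hom)
     map := fun {X Y} g => ModuleCat.ofHom (Submodule.mapQ _ _ (F'.obj.map g).hom (by
       rintro _ ⟨x, rfl⟩
       exact ⟨(F.obj.map g).hom x, congrArg (fun k => k.hom x) (f.hom.naturality g)⟩))
     map_id := fun X => by
       apply ModuleCat.hom_ext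
       refine Submodule.linearMap_qext _ (LinearMap.ext fun x => ?_)
       exact congrArg (Submodule.Quotient.mk) (congrArg (fun k => k.hom x) (F'.obj.map_id X))
     map_comp := fun {X Y Z} g h => by
       apply ModuleCat.hom_ext
       refine Submodule.linearMap_qext _ (LinearMap.ext fun x => ?_)
       exact congrArg (Submodule.Quotient.mk) (congrArg (fun k => k.hom x)
        (F'.obj.map_comp g h)) },
   ⟨fun {X Y g h} => by
     apply ModuleCat.hom_ext
     refine Submodule.linearMap_qext _ (LinearMap.ext fun x => ?_)
     exact congrArg (Submodule.Quotient.mk) (congrArg (fun k => k.hom x)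
        (F'.obj.map_add (f := g) (g := h)))⟩⟩

theorem surjective_app_of_epi {F F' : C ⥤+ ModuleCat.{v} R} (f : F ⟶ F') [Epi f] (X : C) :
    Function.Surjective (f.hom.app X).hom := by
  let π : F' ⟶ pointwiseCoker f := ObjectProperty.homMk
    { app := fun X => ModuleCat.ofHom (Submodule.mkQ _)
      naturality := fun _ _ _ => rfl }
  have h : f ≫ π = f ≫ 0 := by
    ext X x
    exact (Submodule.Quotient.mk_eq_zero _).2 ⟨x, rfl⟩
  have h' := (cancel_epi f).1 h
  intro y
  have hy : (π.hom.app X).hom y = 0 := by rw [h']; rfl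
  exact (Submodule.Quotient.mk_eq_zero _).1 hy

theorem epi_of_surjective_app {F F' : C ⥤+ ModuleCat.{v} R} (f : F ⟶ F')
    (hf : ∀ X, Function.Surjective (f.hom.app X).hom) : Epi f where
  left_cancellation g h w := by
    ext X y
    obtain ⟨x, rfl⟩ := hf X y
    exact congrArg (fun k => (k.hom.app X).hom x) w

/-- The pointwise image of a morphism of additive functors. -/
noncomputable def pointwiseRange {F F' : C ⥤+ ModuleCat.{v} R} (f : F ⟶ F') :
    C ⥤+ ModuleCat.{v} R :=
  ⟨{ obj := fun X => ModuleCat.of R (LinearMap.range (f.hom.app X).hom)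
     map := fun {X Y} g => ModuleCat.ofHom ((F'.obj.map g).hom.restrict (by
       rintro _ ⟨x, rfl⟩
       exact ⟨(F.obj.map g).hom x, congrArg (fun k => k.hom x) (f.hom.naturality g)⟩))
     map_id := fun X => by
       apply ModuleCat.hom_ext
       refine LinearMap.ext fun x => Subtype.ext ?_
       exact congrArg (fun k => k.hom x.1) (F'.obj.map_id X)
     map_comp := fun {X Y Z} g h => by
       apply ModuleCat.hom_ext
       refine LinearMap.ext fun x => Subtype.ext ?_
       exact congrArg (fun k => k.hom x.1) (F'.obj.map_comp g h) },
   ⟨fun {X Y g h} => by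
     apply ModuleCat.hom_ext
     refine LinearMap.ext fun x => Subtype.ext ?_
     exact congrArg (fun k => k.hom x.1) (F'.obj.map_add (f := g) (g := h))⟩⟩

/-- A projective additive functor lifts along `d` every morphism whose values are pointwise in the
image of `d`. -/
theorem exists_lift_of_projective {P F F' : C ⥤+ ModuleCat.{v} R} [Projective P] (d : F ⟶ F')
    (a : P ⟶ F') (h : ∀ X x, (a.hom.app X).hom x ∈ Set.range (d.hom.app X).hom) :
    ∃ b : P ⟶ F, b ≫ d = a := by
  let d' : F ⟶ pointwiseRange d := ObjectProperty.homMk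
    { app := fun X => ModuleCat.ofHom (d.hom.app X).hom.rangeRestrict
      naturality := fun X Y g => by
        apply ModuleCat.hom_ext
        refine LinearMap.ext fun x => Subtype.ext ?_
        exact congrArg (fun k => k.hom x) (d.hom.naturality g) }
  let a' : P ⟶ pointwiseRange d := ObjectProperty.homMk
    { app := fun X => ModuleCat.ofHom ((a.hom.app X).hom.codRestrict _ (h X))
      naturality := fun X Y g => by
        apply ModuleCat.hom_ext
        refine LinearMap.ext fun x => Subtype.ext ?_
        exact congrArg (fun k => k.hom x) (a.hom.naturality g) }
  have : Epi d' := epi_of_surjective_app d' fun X => LinearMap.surjective_rangeRestrict _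
  refine ⟨Projective.factorThru a' d', ?_⟩
  have hb := Projective.factorThru_comp a' d'
  ext X x
  exact congrArg Subtype.val (congrArg (fun k => (k.hom.app X).hom x) hb)

end AdditiveFunctors

/-! ### Fixed point functors of permutation modules are projective -/

section HeckeHom

variable {G : Type v} [Group G] {𝓕 : FiniteSubgroupFamily G} {X Y : HeckeCat 𝓕}

instance HeckeCat.finite_sub (X : HeckeCat 𝓕) : Finite X.sub := 𝓕.finite_mem _ X.mem

/-- The Hecke morphism `G/H ⟶ G/K` sending the generator to a given `H`-fixed element of `ℤ[G/K]`. -/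
noncomputable def HeckeCat.homOfFixed (v : MonoidAlgebra ℤ (G ⧸ Y.sub))
    (hv : ∀ h : X.sub, Representation.ofMulAction ℤ X.sub (G ⧸ Y.sub) h v = v) : X ⟶ Y :=
  let m : fixedPoints (R := ℤ) (Rep.of Y.perm) X.sub := ⟨v, hv⟩
  permIntertwining (orbitFun _ m) (orbitFun_smul _ m)

@[simp]
theorem HeckeCat.toMap_homOfFixed_gen (v : MonoidAlgebra ℤ (G ⧸ Y.sub))
    (hv : ∀ h : X.sub, Representation.ofMulAction ℤ X.sub (G ⧸ Y.sub) h v = v) :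
    HeckeCat.toMap (HeckeCat.homOfFixed v hv) X.gen = v := by
  change permLift (orbitFun (R := ℤ) (Rep.of Y.perm) ⟨v, hv⟩) (MonoidAlgebra.single _ 1) = v
  rw [permLift_single, one_smul]
  change Y.perm 1 v = v
  simp

theorem HeckeCat.hom_ext_gen {f g : X ⟶ Y}
    (h : HeckeCat.toMap f X.gen = HeckeCat.toMap g X.gen) : f = g := by
  refine permIntertwining_ext fun x => ?_
  induction x using Quotient.inductionOn with
  | _ a =>
    have hx : MonoidAlgebra.single (Quotient.mk _ a : G ⧸ X.sub) 1 = X.perm a X.gen := by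
      rw [Representation.ofMulAction_single]
      simp
    change HeckeCat.toMap f _ = HeckeCat.toMap g _
    rw [hx, Representation.IntertwiningMap.isIntertwining,
      Representation.IntertwiningMap.isIntertwining, h]

/-- The Hecke morphism `G/H ⟶ G/K` sending the generator to the sum of the `H`-orbit of `x`. -/
noncomputable def HeckeCat.orbitHom (X Y : HeckeCat 𝓕) (x : G ⧸ Y.sub) : X ⟶ Y :=
  HeckeCat.homOfFixed (orbitSum ℤ X.sub x) (ofMulAction_orbitSum ℤ X.sub x)

/-- The Hecke morphisms `G/H ⟶ G/K` are spanned by those given by the `H`-orbits in `G/K`. -/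
theorem HeckeCat.addMonoidHom_ext {V : Type*} [AddCommGroup V] {f g : (X ⟶ Y) →+ V}
    (h : ∀ x, f (HeckeCat.orbitHom X Y x) = g (HeckeCat.orbitHom X Y x)) : f = g := by
  refine AddMonoidHom.ext fun φ => ?_
  have hφ : φ = ∑ q ∈ (orbitCoeff ℤ X.sub (HeckeCat.toMap φ X.gen)).support,
      orbitCoeff ℤ X.sub (HeckeCat.toMap φ X.gen) q • HeckeCat.orbitHom X Y q.out := by
    apply HeckeCat.hom_ext_gen
    refine (eq_linearCombination_orbitSum (H := X.sub) fun h => ?_).trans ?_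
    · change Y.perm h.1 _ = _
      rw [← Representation.IntertwiningMap.isIntertwining, gen_fixed]
    · let ev : (X ⟶ Y) →+ MonoidAlgebra ℤ (G ⧸ Y.sub) :=
        { toFun := fun ψ => HeckeCat.toMap ψ X.gen
          map_zero' := rfl
          map_add' := fun _ _ => rfl }
      change _ = ev _
      rw [map_sum, Finsupp.linearCombination_apply, Finsupp.sum]
      refine Finset.sum_congr rfl fun q _ => ?_
      rw [map_zsmul]
      exact congrArg _ (HeckeCat.toMap_homOfFixed_gen _ _).symm
  rw [hφ, map_sum, map_sum]
  exact Finset.sum_congr rfl fun q _ => by rw [map_zsmul, map_zsmul, h]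

variable {R : Type u} [CommRing R]

/-- Evaluation of Hecke morphisms `X ⟶ Y` at an element of `M Y`. -/
noncomputable def HeckeCat.evalAt (M : HeckeModule R 𝓕) (m : M.obj.obj (.op Y)) :
    (X ⟶ Y) →+ M.obj.obj (.op X) where
  toFun φ := (M.obj.map φ.op).hom m
  map_zero' := by simp
  map_add' φ ψ := by simp [M.obj.map_add]

end HeckeHom

section Projective

variable {R : Type u} [CommRing R] {G : Type v} [Group G] {𝓕 : FiniteSubgroupFamily G}
  {J : Type v} (K : J → HeckeCat 𝓕)

variable (R) in
/-- The permutation module of the `G`-set `∐ⱼ G/Kⱼ`. -/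
noncomputable abbrev sigmaRep : Rep.{max u v} R G := permRep R G (Σ j, G ⧸ (K j).sub)

variable (R) in
/-- The coset `Kⱼ` as a `Kⱼ`-fixed element of the permutation module of `∐ⱼ G/Kⱼ`. -/
noncomputable def sigmaGen (j : J) : fixedPoints (sigmaRep R K) (K j).sub :=
  ⟨MonoidAlgebra.single ⟨j, ((1 : G) : G ⧸ (K j).sub)⟩ 1, fun h => by
    refine (Representation.ofMulAction_single _ _ _).trans ?_
    congr 1
    exact Sigma.ext rfl (heq_of_eq (QuotientGroup.eq.mpr (by simp)))⟩

theorem orbitFun_sigmaGen (j : J) (x : G ⧸ (K j).sub) :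
    orbitFun _ (sigmaGen R K j) x = MonoidAlgebra.single ⟨j, x⟩ 1 := by
  induction x using Quotient.inductionOn with
  | _ a =>
    refine (Representation.ofMulAction_single _ _ _).trans ?_
    congr 1
    exact Sigma.ext rfl (heq_of_eq (congrArg _ (mul_one a)))

theorem orbitMap_sigmaGen_orbitSum (X : HeckeCat 𝓕) (j : J) (x : G ⧸ (K j).sub) :
    orbitMap _ (sigmaGen R K j) (orbitSum ℤ X.sub x) =
      orbitSum R X.sub (⟨j, x⟩ : Σ j, G ⧸ (K j).sub) := by
  have h : MulAction.orbit X.sub (⟨j, x⟩ : Σ j, G ⧸ (K j).sub) =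
      Sigma.mk j '' MulAction.orbit X.sub x := (Set.range_comp (Sigma.mk j) _)
  refine (map_orbitSum X.sub (orbitMap _ (sigmaGen R K j)).toAddMonoidHom x).trans ?_
  refine Eq.trans ?_ ((congrArg (fun s => ∑ᶠ z ∈ s, MonoidAlgebra.single z (1 : R)) h).trans
    (finsum_mem_image sigma_mk_injective.injOn)).symm
  refine finsum_mem_congr rfl fun z _ => ?_
  refine (orbitMap_single _ _ z 1).trans ?_
  rw [one_smul, orbitFun_sigmaGen]

theorem fixedPointsMap_orbitHom (X : HeckeCat 𝓕) (j : J) (x : G ⧸ (K j).sub) :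
    (fixedPointsMap _ (HeckeCat.orbitHom X (K j) x) (sigmaGen R K j)).1 =
      orbitSum R X.sub (⟨j, x⟩ : Σ j, G ⧸ (K j).sub) := by
  change orbitMap _ (sigmaGen R K j) (HeckeCat.toMap (HeckeCat.orbitHom X (K j) x) X.gen) = _
  rw [HeckeCat.orbitHom, HeckeCat.toMap_homOfFixed_gen, orbitMap_sigmaGen_orbitSum]

/-- The fixed point functor of `R[∐ⱼ G/Kⱼ]` is generated by the cosets `Kⱼ`. -/
theorem sigmaRep_fixedPoints_ext {X : HeckeCat 𝓕} {V : Type*} [AddCommGroup V] [Module R V]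
    {f g : fixedPoints (sigmaRep R K) X.sub →ₗ[R] V}
    (h : ∀ j (φ : X ⟶ K j), f (fixedPointsMap _ φ (sigmaGen R K j)) =
      g (fixedPointsMap _ φ (sigmaGen R K j))) : f = g := by
  refine LinearMap.ext fun u => ?_
  have hu : u = Finsupp.linearCombination R
      (fun q : MulAction.orbitRel.Quotient X.sub (Σ j, G ⧸ (K j).sub) =>
        fixedPointsMap _ (HeckeCat.orbitHom X (K q.out.1) q.out.2) (sigmaGen R K q.out.1))
      (orbitCoeff R X.sub u.1) := by
    apply Subtype.ext
    refine (eq_linearCombination_orbitSum (H := X.sub) fun h => u.2 h).trans ?_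
    refine Eq.trans ?_ (Finsupp.apply_linearCombination R
      (fixedPoints (sigmaRep R K) X.sub).subtype _ _).symm
    congr 2
    exact funext fun q => (fixedPointsMap_orbitHom K X _ _).symm
  rw [hu, Finsupp.apply_linearCombination, Finsupp.apply_linearCombination]
  congr 2
  exact funext fun q => h _ _

variable {K} {M : HeckeModule R 𝓕} (m : ∀ j, M.obj.obj (.op (K j)))

/-- The value on the orbit sum of `ω` of the morphism sending the generators `Kⱼ` to `m j`. -/
noncomputable def sigmaVal (X : HeckeCat 𝓕) (ω : Σ j, G ⧸ (K j).sub) : M.obj.obj (.op X) :=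
  HeckeCat.evalAt M (m ω.1) (HeckeCat.orbitHom X (K ω.1) ω.2)

theorem sigmaVal_smul (X : HeckeCat 𝓕) (h : X.sub) (ω : Σ j, G ⧸ (K j).sub) :
    sigmaVal m X (h • ω) = sigmaVal m X ω := by
  have : HeckeCat.orbitHom X (K ω.1) (h • ω.2) = HeckeCat.orbitHom X (K ω.1) ω.2 := by
    apply HeckeCat.hom_ext_gen
    rw [HeckeCat.orbitHom, HeckeCat.orbitHom, HeckeCat.toMap_homOfFixed_gen,
      HeckeCat.toMap_homOfFixed_gen]
    exact orbitSum_eq_of_mem _ _ ⟨h, rfl⟩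
  exact congrArg (HeckeCat.evalAt M (m ω.1)) this

/-- The components of the morphism from the fixed point functor of `R[∐ⱼ G/Kⱼ]` to `M` sending the
generators `Kⱼ` to `m j`: the orbit sums form a basis of the fixed points. -/
noncomputable def sigmaLift (X : HeckeCat 𝓕) :
    fixedPoints (sigmaRep R K) X.sub →ₗ[R] M.obj.obj (.op X) :=
  Finsupp.linearCombination R (Quotient.lift (sigmaVal m X) (by
      rintro _ ω ⟨h, rfl⟩
      exact sigmaVal_smul m X h ω)) ∘ₗ
    orbitCoeff R X.sub ∘ₗ (fixedPoints (sigmaRep R K) X.sub).subtype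

theorem sigmaLift_fixedPointsMap {X : HeckeCat 𝓕} {j : J} (φ : X ⟶ K j) :
    sigmaLift m X (fixedPointsMap _ φ (sigmaGen R K j)) = (M.obj.map φ.op).hom (m j) := by
  suffices h : (sigmaLift m X).toAddMonoidHom.comp (HeckeCat.evalAt
      (fixedPointFunctor 𝓕 (sigmaRep R K)) (sigmaGen R K j)) = HeckeCat.evalAt M (m j) from
    DFunLike.congr_fun h φ
  refine HeckeCat.addMonoidHom_ext fun x => ?_
  change Finsupp.linearCombination R _ (orbitCoeff R X.sub
    (fixedPointsMap _ (HeckeCat.orbitHom X (K j) x) (sigmaGen R K j)).1) = _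
  rw [fixedPointsMap_orbitHom, orbitCoeff_orbitSum, Finsupp.linearCombination_single, one_smul]
  rfl

/-- The fixed point functor of `R[∐ⱼ G/Kⱼ]` is freely generated by the cosets `Kⱼ`. -/
noncomputable def sigmaDesc : fixedPointFunctor 𝓕 (sigmaRep R K) ⟶ M :=
  ObjectProperty.homMk
    { app := fun X => ModuleCat.ofHom (sigmaLift m X.unop)
      naturality := fun X Y f => by
        apply ModuleCat.hom_ext
        refine sigmaRep_fixedPoints_ext K fun j φ => ?_
        have h := congrArg (fun k => k.hom (sigmaGen R K j))
          ((fixedPointFunctor 𝓕 (sigmaRep R K)).obj.map_comp φ.op f)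
        change sigmaLift m Y.unop (fixedPointsMap _ f.unop (fixedPointsMap _ φ _)) =
          (M.obj.map f).hom (sigmaLift m X.unop (fixedPointsMap _ φ _))
        change fixedPointsMap _ (f.unop ≫ φ) _ = fixedPointsMap _ f.unop (fixedPointsMap _ φ _) at h
        rw [← h, sigmaLift_fixedPointsMap, sigmaLift_fixedPointsMap]
        exact congrArg (fun k => k.hom (m j)) (M.obj.map_comp φ.op f) }

theorem projective_fixedPointFunctor_sigmaRep (K : J → HeckeCat 𝓕) :
    Projective (fixedPointFunctor 𝓕 (sigmaRep R K)) where
  factors {E N} a e _ := by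
    choose m hm using fun j => surjective_app_of_epi e (.op (K j))
      ((a.hom.app (.op (K j))).hom (sigmaGen R K j))
    refine ⟨sigmaDesc m, ?_⟩
    ext X : 3
    apply ModuleCat.hom_ext
    refine sigmaRep_fixedPoints_ext (X := X.unop) K fun j φ => ?_
    change (e.hom.app X).hom (sigmaLift m X.unop (fixedPointsMap _ φ _)) = _
    rw [sigmaLift_fixedPointsMap]
    have h1 := congrArg (fun k => k.hom (m j)) (e.hom.naturality φ.op)
    have h2 := congrArg (fun k => k.hom (sigmaGen R K j)) (a.hom.naturality φ.op)
    refine h1.trans (Eq.trans ?_ h2.symm)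
    exact congrArg (N.obj.map φ.op).hom (hm j)

end Projective

/-! ### Functoriality of fixed points -/

section FixedPointFunctor

variable {R : Type u} [CommRing R] {G : Type v} [Group G] {𝓕 : FiniteSubgroupFamily G}

theorem map_orbitMap {M N : Rep.{max u v} R G} (f : M ⟶ N) {H : Subgroup G} {m : fixedPoints M H}
    {m' : fixedPoints N H} (hm : m'.1 = f.hom m.1) (v : MonoidAlgebra ℤ (G ⧸ H)) :
    f.hom (orbitMap M m v) = orbitMap N m' v := by
  induction v using MonoidAlgebra.induction_linear with
  | zero => simp
  | add a b ha hb => simp only [map_add, ha, hb]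
  | single x z =>
    rw [orbitMap_single, orbitMap_single, map_zsmul]
    congr 1
    induction x using Quotient.inductionOn with
    | _ a =>
      change f.hom (M.ρ a m.1) = N.ρ a m'.1
      rw [hm, Rep.hom_comm_apply]

/-- The map on fixed point functors induced by a map of `RG`-modules. -/
noncomputable def fixedPointFunctorMap (𝓕 : FiniteSubgroupFamily G) {M N : Rep.{max u v} R G}
    (f : M ⟶ N) : fixedPointFunctor 𝓕 M ⟶ fixedPointFunctor 𝓕 N :=
  ObjectProperty.homMk
    { app := fun X => ModuleCat.ofHom (f.hom.toLinearMap.restrict fun m hm h => by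
        change N.ρ h.1 (f.hom m) = f.hom m
        rw [← Rep.hom_comm_apply]
        exact congrArg f.hom (hm h))
      naturality := fun X Y φ => by
        apply ModuleCat.hom_ext
        refine LinearMap.ext fun m => Subtype.ext ?_
        exact map_orbitMap f rfl _ }

theorem fixedPointFunctorMap_comp {M N P : Rep.{max u v} R G} (f : M ⟶ N) (g : N ⟶ P) :
    fixedPointFunctorMap 𝓕 (f ≫ g) = fixedPointFunctorMap 𝓕 f ≫ fixedPointFunctorMap 𝓕 g := rfl

theorem fixedPointFunctorMap_zero (M N : Rep.{max u v} R G) :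
    fixedPointFunctorMap 𝓕 (0 : M ⟶ N) = 0 := rfl

theorem fixedPointFunctorMap_id (M : Rep.{max u v} R G) :
    fixedPointFunctorMap 𝓕 (𝟙 M) = 𝟙 _ := rfl

/-- The fixed point functor preserves retracts. -/
noncomputable def retractFixedPointFunctor {M N : Rep.{max u v} R G} (r : Retract M N) :
    Retract (fixedPointFunctor 𝓕 M) (fixedPointFunctor 𝓕 N) where
  i := fixedPointFunctorMap 𝓕 r.i
  r := fixedPointFunctorMap 𝓕 r.r
  retract := by rw [← fixedPointFunctorMap_comp, r.retract, fixedPointFunctorMap_id]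

/-- The trivial subgroup, as an object of the Hecke category. -/
def HeckeCat.bot (𝓕 : FiniteSubgroupFamily G) : HeckeCat 𝓕 :=
  ⟨⊥, by
    obtain ⟨H, hH⟩ := 𝓕.nonempty
    exact 𝓕.le_mem H hH ⊥ bot_le⟩

/-- The identification of `M` with its fixed points under the trivial subgroup. -/
noncomputable def botFixedPoints (𝓕 : FiniteSubgroupFamily G) (M : Rep.{max u v} R G) :
    M ≃ₗ[R] fixedPoints M (HeckeCat.bot 𝓕).sub where
  toFun m := ⟨m, fun h => by
    obtain ⟨h, rfl⟩ := h
    change M.ρ 1 m = m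
    simp⟩
  map_add' _ _ := rfl
  map_smul' _ _ := rfl
  invFun m := m.1
  left_inv _ := rfl
  right_inv _ := rfl

/-- The right multiplication by `g` on `ℤ[G]`, as an endomorphism of the free orbit. -/
noncomputable def HeckeCat.botHom (𝓕 : FiniteSubgroupFamily G) (g : G) :
    HeckeCat.bot 𝓕 ⟶ HeckeCat.bot 𝓕 :=
  HeckeCat.homOfFixed (MonoidAlgebra.single (g : G ⧸ (HeckeCat.bot 𝓕).sub) 1) fun h => by
    obtain ⟨h, rfl⟩ := h
    rw [Representation.ofMulAction_single]
    congr 1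
    exact one_smul G (g : G ⧸ (HeckeCat.bot 𝓕).sub)

theorem fixedPointsMap_botHom (M : Rep.{max u v} R G) (g : G) (m : M) :
    fixedPointsMap M (HeckeCat.botHom 𝓕 g) (botFixedPoints 𝓕 M m) =
      botFixedPoints 𝓕 M (M.ρ g m) := by
  apply Subtype.ext
  change orbitMap M (botFixedPoints 𝓕 M m) (HeckeCat.toMap (HeckeCat.botHom 𝓕 g) _) = M.ρ g m
  rw [HeckeCat.botHom, HeckeCat.toMap_homOfFixed_gen, orbitMap_single, one_smul]
  rfl

/-- The value at the trivial subgroup of a morphism of fixed point functors: naturality with respect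
to the automorphisms of the free orbit makes it `G`-equivariant. -/
noncomputable def evalBot {M N : Rep.{max u v} R G}
    (α : fixedPointFunctor 𝓕 M ⟶ fixedPointFunctor 𝓕 N) : M ⟶ N :=
  Rep.ofHom ⟨(botFixedPoints 𝓕 N).symm.toLinearMap ∘ₗ
    (α.hom.app (.op (HeckeCat.bot 𝓕))).hom ∘ₗ (botFixedPoints 𝓕 M).toLinearMap, fun g => by
      refine LinearMap.ext fun m => (botFixedPoints 𝓕 N).injective ?_
      have h := congrArg (fun k => k.hom (botFixedPoints 𝓕 M m))
        (α.hom.naturality (HeckeCat.botHom 𝓕 g).op)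
      change (α.hom.app (.op (HeckeCat.bot 𝓕))).hom (botFixedPoints 𝓕 M (M.ρ g m)) =
        botFixedPoints 𝓕 N (N.ρ g _)
      rw [← fixedPointsMap_botHom, ← fixedPointsMap_botHom]
      exact h⟩

/-- The fixed points of an augmented complex of `RG`-modules. -/
noncomputable def AugComplex.fixedPoints (𝓕 : FiniteSubgroupFamily G) {M : Rep.{max u v} R G}
    (X : AugComplex M) : AugComplex (fixedPointFunctor 𝓕 M) where
  P i := fixedPointFunctor 𝓕 (X.P i)
  d i := fixedPointFunctorMap 𝓕 (X.d i)
  ε := fixedPointFunctorMap 𝓕 X.ε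
  d_ε := by rw [← fixedPointFunctorMap_comp, X.d_ε, fixedPointFunctorMap_zero]
  d_d i := by rw [← fixedPointFunctorMap_comp, X.d_d, fixedPointFunctorMap_zero]

/-! ### Exactness and lifting for complexes of `ℋ_𝓕`-modules -/

/-- Pointwise exactness of an augmented complex of `ℋ_𝓕`-modules. -/
structure AugComplex.IsPointwiseExact {M : HeckeModule R 𝓕} (X : AugComplex M) : Prop where
  surjective_ε : ∀ Z, Function.Surjective (X.ε.hom.app Z).hom
  exact_zero : ∀ Z, Function.Exact ((X.d 0).hom.app Z).hom (X.ε.hom.app Z).hom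
  exact_succ : ∀ i Z, Function.Exact ((X.d (i + 1)).hom.app Z).hom ((X.d i).hom.app Z).hom

theorem AugComplex.IsPointwiseExact.lifts {M : HeckeModule R 𝓕} {X : AugComplex M}
    (hX : X.IsPointwiseExact) (P : HeckeModule R 𝓕) [Projective P] : AugComplex.Lifts P X where
  ε a := exists_lift_of_projective _ a fun Z _ => hX.surjective_ε Z _
  zero a ha := exists_lift_of_projective _ a fun Z x =>
    (hX.exact_zero Z _).1 (congrArg (fun k => (k.hom.app Z).hom x) ha)
  succ i a ha := exists_lift_of_projective _ a fun Z x =>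
    (hX.exact_succ i Z _).1 (congrArg (fun k => (k.hom.app Z).hom x) ha)

/-- Contracting homotopies that are linear over the subgroups in `𝓕` preserve fixed points. -/
theorem AugComplex.isPointwiseExact_fixedPoints {M : Rep.{max u v} R G} (X : AugComplex M)
    (hX : ∀ H ∈ 𝓕.carrier, X.SplitsOver H) : (X.fixedPoints 𝓕).IsPointwiseExact where
  surjective_ε Z m := by
    obtain ⟨t, s, h₁, h₂, h₃⟩ := hX _ Z.unop.mem
    refine ⟨⟨t m.1, fun h => ?_⟩, Subtype.ext (h₁ m.1)⟩
    rw [← t.isIntertwining, m.2 h]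
  exact_zero Z x := by
    obtain ⟨t, s, h₁, h₂, h₃⟩ := hX _ Z.unop.mem
    refine ⟨fun hx => ⟨⟨s 0 x.1, fun h => ?_⟩, Subtype.ext ?_⟩, ?_⟩
    · rw [← (s 0).isIntertwining, x.2 h]
    · have h0 : X.ε.hom x.1 = 0 := congrArg Subtype.val hx
      have := h₂ x.1
      rwa [h0, map_zero, add_zero] at this
    · rintro ⟨y, rfl⟩
      exact congrArg (fun k => (k.hom.app Z).hom y) (X.fixedPoints 𝓕).d_ε
  exact_succ i Z x := by
    obtain ⟨t, s, h₁, h₂, h₃⟩ := hX _ Z.unop.mem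
    refine ⟨fun hx => ⟨⟨s (i + 1) x.1, fun h => ?_⟩, Subtype.ext ?_⟩, ?_⟩
    · rw [← (s (i + 1)).isIntertwining, x.2 h]
    · have h0 : (X.d i).hom x.1 = 0 := congrArg Subtype.val hx
      have := h₃ i x.1
      rwa [h0, map_zero, add_zero] at this
    · rintro ⟨y, rfl⟩
      exact congrArg (fun k => (k.hom.app Z).hom y) ((X.fixedPoints 𝓕).d_d i)

/-! ### Projectivity of the fixed points of the bar complex -/

/-- A `G`-set with stabilisers in `𝓕` is a disjoint union of orbits `G/K` with `K ∈ 𝓕`. -/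
theorem projective_fixedPointFunctor_permRep (Y : Type v) [MulAction G Y]
    (hY : ∀ y : Y, MulAction.stabilizer G y ∈ 𝓕.carrier) :
    Projective (fixedPointFunctor 𝓕 (permRep R G Y)) := by
  let K : MulAction.orbitRel.Quotient G Y → HeckeCat 𝓕 := fun q => ⟨_, hY q.out⟩
  let f : (Σ q, G ⧸ (K q).sub) → Y := fun p => MulAction.ofQuotientStabilizer G p.1.out p.2
  have hf : ∀ (g : G) p, f (g • p) = g • f p := fun g p =>
    MulAction.ofQuotientStabilizer_smul G _ g p.2
  have hf_mk : ∀ p, Quotient.mk (MulAction.orbitRel G Y) (f p) = p.1 := by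
    rintro ⟨q, x⟩
    refine Eq.trans (Quotient.sound ?_) q.out_eq
    exact MulAction.ofQuotientStabilizer_mem_orbit G _ x
  have hbij : Function.Bijective f := by
    constructor
    · rintro ⟨q, x⟩ ⟨q', x'⟩ h
      obtain rfl : q = q' :=
        (hf_mk ⟨q, x⟩).symm.trans ((congrArg _ h).trans (hf_mk ⟨q', x'⟩))
      exact Sigma.ext rfl (heq_of_eq (MulAction.injective_ofQuotientStabilizer G q.out h))
    · intro y
      obtain ⟨g, hg⟩ := (MulAction.orbitRel_apply).1
        ((MulAction.orbitRel G Y).symm (Quotient.mk_out (s := MulAction.orbitRel G Y) y))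
      exact ⟨⟨Quotient.mk (MulAction.orbitRel G Y) y, (g : G ⧸ MulAction.stabilizer G
        (Quotient.mk (MulAction.orbitRel G Y) y).out)⟩, hg⟩
  let e := Equiv.ofBijective f hbij
  have he : ∀ (g : G) y, e.symm (g • y) = g • e.symm y := fun g y => by
    rw [Equiv.symm_apply_eq]
    change _ = f _
    rw [hf]
    exact congrArg _ (e.apply_symm_apply y).symm
  let r : Retract (permRep R G Y) (sigmaRep R K) :=
    { i := Rep.ofHom (permIntertwining (fun y => MonoidAlgebra.single (e.symm y) 1)
        fun g y => by rw [he, Representation.ofMulAction_single])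
      r := Rep.ofHom (permIntertwining (fun p => MonoidAlgebra.single (f p) 1)
        fun g p => by rw [hf, Representation.ofMulAction_single])
      retract := by
        apply Rep.hom_ext
        refine permIntertwining_ext fun y => ?_
        change permLift _ (permLift _ (MonoidAlgebra.single y 1)) = MonoidAlgebra.single y 1
        rw [permLift_single, one_smul, permLift_single, one_smul]
        exact congrArg (MonoidAlgebra.single · 1) (e.apply_symm_apply y) }
  have := projective_fixedPointFunctor_sigmaRep (R := R) K
  exact (retractFixedPointFunctor r).projective

/-- A point stabiliser of `X ^ (n + 1)` is contained in one of `X`. -/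
theorem projective_fixedPoints_barComplex (n : ℕ) :
    Projective (((barComplex R 𝓕.Delta G).fixedPoints 𝓕).P n) := by
  refine projective_fixedPointFunctor_permRep _ fun y => ?_
  obtain ⟨⟨H, x⟩, h⟩ : ∃ δ, y 0 = δ := ⟨_, rfl⟩
  induction x using Quotient.inductionOn with
  | _ a =>
    refine 𝓕.le_mem _ (𝓕.conj_mem H.1 H.2 a) _ fun g hg => ?_
    have h1 : g • y 0 = y 0 := congrFun hg 0
    rw [h] at h1
    have h2 : ((g * a : G) : G ⧸ H.1) = (a : G ⧸ H.1) := eq_of_heq (Sigma.mk.inj h1).2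
    refine ⟨a⁻¹ * g * a, ?_, by simp [mul_assoc]⟩
    have := QuotientGroup.eq.mp h2.symm
    rwa [← mul_assoc] at this

/-! ### Equality of the two dimensions -/

/-- A projective resolution of `R^-` of length `n` makes the `n`-th boundary of the bar complex
split. -/
theorem HasHeckeResolution.exists_barComplex_d_comp_d {n : ℕ} (h : HasHeckeResolution R 𝓕 n) :
    ∃ k : (barComplex R 𝓕.Delta G).P n ⟶ (barComplex R 𝓕.Delta G).P (n + 1),
      (barComplex R 𝓕.Delta G).d n ≫ k ≫ (barComplex R 𝓕.Delta G).d n =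
        (barComplex R 𝓕.Delta G).d n := by
  obtain ⟨C, h0⟩ := h
  have hext : ∀ {F F' : HeckeModule R 𝓕} {α : F ⟶ F'},
      (∀ Z x, (α.hom.app Z).hom x = 0) → α = 0 := fun hα => by
    ext Z x
    exact hα Z x
  let Y : AugComplex (fixedPointFunctor 𝓕 (trivialRep R G)) :=
    { P := C.P
      d := C.d
      ε := C.ε
      d_ε := hext fun Z x => (C.exact_zero Z _).2 ⟨x, rfl⟩
      d_d := fun i => hext fun Z x => (C.exact_succ i Z _).2 ⟨x, rfl⟩ }
  have hY : Y.IsPointwiseExact := ⟨C.surjective_ε, C.exact_zero, C.exact_succ⟩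
  have hX := (barComplex R 𝓕.Delta G).isPointwiseExact_fixedPoints (barComplex_delta_splitsOver 𝓕)
  have hXP := projective_fixedPoints_barComplex (R := R) (𝓕 := 𝓕)
  have hYP : ∀ i, Projective (Y.P i) := C.projective
  have hzero : Limits.IsZero (Y.P (n + 1)) := by
    refine (Limits.IsZero.iff_id_eq_zero _).2 (hext fun Z x => ?_)
    have := h0 _ n.lt_succ_self Z
    exact Subsingleton.elim _ _
  obtain ⟨k, hk⟩ := AugComplex.exists_d_comp_d_eq ((barComplex R 𝓕.Delta G).fixedPoints 𝓕) Y
    (fun i => hY.lifts _) (fun i => hX.lifts _) (fun i => hX.lifts _) n hzero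
  exact ⟨evalBot k, congrArg evalBot hk⟩

/-- If the `n`-th boundary of the bar complex splits, then its truncation in degree `n` is an
`𝓕`-split `𝓕`-projective resolution, and its fixed points are a projective resolution of `R^-`. -/
theorem hasFResolution_and_hasHeckeResolution {n : ℕ}
    (h : ∃ k : (barComplex R 𝓕.Delta G).P n ⟶ (barComplex R 𝓕.Delta G).P (n + 1),
      (barComplex R 𝓕.Delta G).d n ≫ k ≫ (barComplex R 𝓕.Delta G).d n =
        (barComplex R 𝓕.Delta G).d n) : HasFResolution R 𝓕 n ∧ HasHeckeResolution R 𝓕 n := by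
  obtain ⟨k, hk⟩ := h
  obtain ⟨X, hr, hS, h0⟩ := AugComplex.exists_truncation _ n k hk
  have hS' : ∀ H ∈ 𝓕.carrier, X.SplitsOver H := fun H hH =>
    hS H (barComplex_delta_splitsOver 𝓕 H hH)
  constructor
  · obtain ⟨H, hH⟩ := 𝓕.nonempty
    exact ⟨X.toRepResolution H (hS' H hH),
      fun i => (isFProjective_barComplex 𝓕 i).of_retract (hr i).some, hS', h0⟩
  · have hX := X.isPointwiseExact_fixedPoints hS'
    refine ⟨⟨(X.fixedPoints 𝓕).P, fun i => ?_, (X.fixedPoints 𝓕).d, (X.fixedPoints 𝓕).ε,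
      hX.surjective_ε, hX.exact_zero, hX.exact_succ⟩, fun i hi Z => ?_⟩
    · have : Projective (fixedPointFunctor 𝓕 ((barComplex R 𝓕.Delta G).P i)) :=
        projective_fixedPoints_barComplex i
      exact (retractFixedPointFunctor (hr i).some).projective
    · have := h0 i hi
      exact inferInstanceAs (Subsingleton (fixedPoints (X.P i) Z.unop.sub))

end FixedPointFunctor

theorem mainTheorem1 (R : Type u) [CommRing R] (G : Type v) [Group G]
    (𝓕 : FiniteSubgroupFamily G) :
    FCohomologicalDimension R 𝓕 = HeckeCohomologicalDimension R 𝓕 := by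
  have h : ∀ n, HasFResolution R 𝓕 n ↔ HasHeckeResolution R 𝓕 n := fun n =>
    ⟨fun h => (hasFResolution_and_hasHeckeResolution h.exists_barComplex_d_comp_d).2,
      fun h => (hasFResolution_and_hasHeckeResolution h.exists_barComplex_d_comp_d).1⟩
  simp only [FCohomologicalDimension, HeckeCohomologicalDimension, h]
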